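/- **Setting.** Let $(X,d)$ be a complete metric space and let $\phi:X\to(-\infty,\infty]$ be lower semicontinuous with $D(\phi):=\{x\mid\phi(x)<\infty\}\neq\emptyset$. A minimal geodesic is a curve $\gamma:[0,1]\to X$ with $d(\gamma(s),\gamma(t))=|s-t|\,d(\gamma(0),\gamma(1))$ for all $s,t$. For $\lambda\in\mathbb R$, $\phi$ satisfies the $\lambda$-convexity inequality along $\gamma$ if $$\phi(\gamma(t))\le(1-t)\phi(\gamma(0))+t\phi(\gamma(1))-\tfrac{\lambda}{2}(1-t)t\,d^2(\gamma(0),\gamma(1))\qquad(t\in[0,1]),$$ and $\phi$ is $\lambda$-convex if any two points of $D(\phi)$ are joined by some minimal geodesic along which this holds. For $\tau>0$ put $$\phi_\tau(x):=\inf_{z\in X}\Big\{\phi(z)+\frac{d^2(x,z)}{2\tau}\Big\},\qquad J_\tau(x):=\Big\{z\in X\,\Big|\,\phi(z)+\frac{d^2(x,z)}{2\tau}=\phi_\tau(x)\Big\}.$$ $\phi$ is coercive if there is $\tau_*>0$ such that $\phi_\tau(x)>-\infty$ and $J_\tau(x)\ne\emptyset$ for all $x\in X$ and $\tau\in(0,\tau_*)$.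 Assume one of the following, for some $\lambda\in\mathbb R$. * **Case I.** $(X,d)$ is a CAT(1)-space (any two points are joined by a minimal geodesic, and for all $x,y,z$ with $d(x,y)+d(y,z)+d(z,x)<2\pi$ and every minimal geodesic $\gamma$ from $y$ to $z$, $d(x,\gamma(t))\le d_{\mathbb S^2}(\tilde x,\tilde\gamma(t))$ for all $t\in[0,1]$, where $\tilde x\tilde y\tilde z$ is a comparison triangle in the unit sphere $\mathbb S^2$ and $\tilde\gamma$ is the minimal geodesic from $\tilde y$ to $\tilde z$); $\phi$ is $\lambda$-convex; and $\operatorname{diam}X<\pi/2$ or $\phi$ is coercive. * **Case II.** $\phi$ is coercive, and there are $K\in\mathbb R$ and a family $\Gamma$ of minimal geodesics of $X$ such that: any two points of $D(\phi)$ are joined by a member of $\Gamma$; the $\lambda$-convexity inequality of $\phi$ holds along every $\gamma\in\Gamma$ with endpoints in $D(\phi)$; for all $\gamma\in\Gamma$, $z\in X$ and $t\in[0,1]$, $$d^2(\gamma(t),z)\le(1-t)d^2(\gamma(0),z)+t\,d^2(\gamma(1),z)-\tfrac K2(1-t)t\,d^2(\gamma(0),\gamma(1));$$ and for all $\gamma,\eta\in\Gamma$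 with $\gamma(0)=\eta(0)=:x$ the following limits exist and agree (commutativity): $$\lim_{s\downarrow0}\frac{d^2(\gamma(s),\eta(1))-d^2(x,\eta(1))}{s}=\lim_{t\downarrow0}\frac{d^2(\eta(t),\gamma(1))-d^2(x,\gamma(1))}{t}.$$ A partition $\boldsymbol\tau$ is a sequence $0=t^0<t^1<\cdots$ with $t^k\to\infty$; its mesh is $|\boldsymbol\tau|:=\sup_k(t^k-t^{k-1})$. A discrete solution from $x_0\in D(\phi)$ is a sequence with $x^0=x_0$ and $x^k\in J_{t^k-t^{k-1}}(x^{k-1})$ for $k\ge1$; its interpolation is $\bar x_{\boldsymbol\tau}(0)=x_0$, $\bar x_{\boldsymbol\tau}(t)=x^k$ for $t\in(t^{k-1},t^k]$. **Theorem (unique limits of discrete solutions).** (i) There is $\delta>0$ such that for every partition with $|\boldsymbol\tau|<\delta$ and every $x_0\in D(\phi)$ there is a discrete solution from $x_0$. (ii) For every $x_0\in D(\phi)$ there is exactly one curve $\xi:[0,\infty)\to X$ with $\xi(0)=x_0$ such that, for every sequence of partitions $\boldsymbol\tau_i$ with $|\boldsymbol\tau_i|\to0$ and all choices of associated discrete solutions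 from $x_0$, the interpolations $\bar x_{\boldsymbol\tau_i}$ converge to $\xi$ uniformly on $[0,T]$ for every $T\geq 0$. In particular, $\xi$ does not depend on the partitions or on the discrete solutions. (iii) Put $\mathcal G(t,x_0):=\xi(t)$. Then $\mathcal G$ maps $[0,\infty)\times D(\phi)$ to $D(\phi)$, $t\mapsto\mathcal G(t,x_0)$ is continuous, $\mathcal G(0,x_0)=x_0$, and $\mathcal G(t,\mathcal G(s,x_0))=\mathcal G(s+t,x_0)$ for all $s,t\ge0$ and $x_0\in D(\phi)$. -/

import Mathlib

open Set Filter Topology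
open scoped NNReal ENNReal

noncomputable section

namespace GradFlow

/-- `γ`, restricted to `[0,1]`, is a minimal geodesic of constant speed from `y` to `z` for the
distance function `δ`. Values of `γ` outside `[0,1]` play no role. -/
def IsMinGeodesicFor {Y : Type*} (δ : Y → Y → ℝ) (γ : ℝ → Y) (y z : Y) : Prop :=
  γ 0 = y ∧ γ 1 = z ∧ ∀ s ∈ Icc (0 : ℝ) 1, ∀ t ∈ Icc (0 : ℝ) 1, δ (γ s) (γ t) = |s - t| * δ y z

/-- Minimal geodesics of a metric space. -/
def IsMinGeodesic {X : Type*} [MetricSpace X] (γ : ℝ → X) (y z : X) : Prop :=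
  IsMinGeodesicFor (fun p q : X => dist p q) γ y z

/-- The unit sphere of Euclidean three-space. -/
abbrev S2 : Type := Metric.sphere (0 : EuclideanSpace ℝ (Fin 3)) 1

/-- The intrinsic (angular) distance of the unit sphere. -/
def sphereDist (p q : S2) : ℝ :=
  InnerProductGeometry.angle (p : EuclideanSpace ℝ (Fin 3)) (q : EuclideanSpace ℝ (Fin 3))

/-- CAT(1)-spaces: geodesic spaces whose triangles of perimeter less than `2π` are not thicker
than their comparison triangles in the unit sphere. The comparison triangle `a b c` is unique up
to isometries of the sphere and its side `σ` from `b` to `c` is then unique since `d(y,z) < π`,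
so it does not matter which one is taken. -/
def IsCAT1 (X : Type*) [MetricSpace X] : Prop :=
  (∀ x y : X, ∃ γ : ℝ → X, IsMinGeodesic γ x y) ∧
  ∀ (x y z : X) (γ : ℝ → X),
    dist x y + dist y z + dist z x < 2 * Real.pi → IsMinGeodesic γ y z →
    ∃ (a b c : S2) (σ : ℝ → S2),
      sphereDist a b = dist x y ∧ sphereDist b c = dist y z ∧ sphereDist c a = dist z x ∧
      IsMinGeodesicFor sphereDist σ b c ∧
      ∀ t ∈ Icc (0 : ℝ) 1, dist x (γ t) ≤ sphereDist a (σ t)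

variable {X : Type*}

/-- The proper domain `D(φ)` of a function with values in `(-∞,∞]`. -/
def dom (φ : X → EReal) : Set X := {x | φ x ≠ ⊤}

variable [MetricSpace X]

/-- The inequality of `lam`-convexity of `φ` along the curve `γ`. -/
def ConvexAlong (φ : X → EReal) (lam : ℝ) (γ : ℝ → X) : Prop :=
  ∀ t ∈ Icc (0 : ℝ) 1,
    φ (γ t) ≤ ((1 - t : ℝ) : EReal) * φ (γ 0) + (t : EReal) * φ (γ 1)
      - ((lam / 2 * (1 - t) * t * dist (γ 0) (γ 1) ^ 2 : ℝ) : EReal)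

/-- `lam`-convexity: any two points of the domain are joined by some minimal geodesic along which
the convexity inequality holds. -/
def IsLamConvex (φ : X → EReal) (lam : ℝ) : Prop :=
  ∀ x ∈ dom φ, ∀ y ∈ dom φ, ∃ γ : ℝ → X, IsMinGeodesic γ x y ∧ ConvexAlong φ lam γ

/-- `K`-convexity along `γ` of the squared distance from every point. -/
def SqDistConvexAlong (K : ℝ) (γ : ℝ → X) : Prop :=
  ∀ z : X, ∀ t ∈ Icc (0 : ℝ) 1,
    dist (γ t) z ^ 2 ≤ (1 - t) * dist (γ 0) z ^ 2 + t * dist (γ 1) z ^ 2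
      - K / 2 * (1 - t) * t * dist (γ 0) (γ 1) ^ 2

/-- Commutativity for two geodesics issuing from the same point: both one-sided derivatives of
the squared distance exist, and they agree. -/
def CommutesWith (γ η : ℝ → X) : Prop :=
  ∃ L : ℝ,
    Tendsto (fun s : ℝ => (dist (γ s) (η 1) ^ 2 - dist (γ 0) (η 1) ^ 2) / s) (𝓝[>] 0) (𝓝 L) ∧
    Tendsto (fun t : ℝ => (dist (η t) (γ 1) ^ 2 - dist (η 0) (γ 1) ^ 2) / t) (𝓝[>] 0) (𝓝 L)

/-- The Moreau-Yosida approximation. -/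
def moreauYosida (φ : X → EReal) (τ : ℝ) (x : X) : EReal :=
  ⨅ z : X, (φ z + ((dist x z ^ 2 / (2 * τ) : ℝ) : EReal))

/-- The set of points attaining the infimum in the Moreau-Yosida approximation. -/
def resolventSet (φ : X → EReal) (τ : ℝ) (x : X) : Set X :=
  {z | φ z + ((dist x z ^ 2 / (2 * τ) : ℝ) : EReal) = moreauYosida φ τ x}

/-- Coercivity. -/
def IsCoercive (φ : X → EReal) : Prop :=
  ∃ τs : ℝ, 0 < τs ∧ ∀ τ : ℝ, 0 < τ → τ < τs → ∀ x : X,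
    moreauYosida φ τ x ≠ ⊥ ∧ (resolventSet φ τ x).Nonempty

/-- Case I: a CAT(1)-space and a `lam`-convex function, where either the diameter of the space is
less than `π/2` or the function is coercive. -/
def CaseI (φ : X → EReal) (lam : ℝ) : Prop :=
  IsCAT1 X ∧ IsLamConvex φ lam ∧
    (Metric.ediam (univ : Set X) < ENNReal.ofReal (Real.pi / 2) ∨ IsCoercive φ)

/-- Case II: a coercive function and a family `Γ` of minimal geodesics that joins any two points
of the domain, such that the commutativity, the `K`-convexity of the squared distance and the
`lam`-convexity of `φ` hold along the members of `Γ`. -/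
def CaseII (φ : X → EReal) (lam : ℝ) : Prop :=
  IsCoercive φ ∧ ∃ (K : ℝ) (Γ : Set (ℝ → X)),
    (∀ γ ∈ Γ, IsMinGeodesic γ (γ 0) (γ 1)) ∧
    (∀ x ∈ dom φ, ∀ y ∈ dom φ, ∃ γ ∈ Γ, γ 0 = x ∧ γ 1 = y) ∧
    (∀ γ ∈ Γ, γ 0 ∈ dom φ → γ 1 ∈ dom φ → ConvexAlong φ lam γ) ∧
    (∀ γ ∈ Γ, SqDistConvexAlong K γ) ∧
    (∀ γ ∈ Γ, ∀ η ∈ Γ, γ 0 = η 0 → CommutesWith γ η)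

/-- Partitions `0 = t⁰ < t¹ < ⋯` of `[0,∞)` with `tᵏ → ∞`. -/
structure TimePartition where
  t : ℕ → ℝ
  t_zero : t 0 = 0
  strictMono : StrictMono t
  tendsto : Tendsto t atTop atTop

/-- The mesh `sup_k (tᵏ⁺¹ - tᵏ)`, possibly infinite. -/
def TimePartition.mesh (P : TimePartition) : ℝ≥0∞ :=
  ⨆ k : ℕ, ENNReal.ofReal (P.t (k + 1) - P.t k)

/-- Discrete solutions of the minimizing movement scheme. -/
def IsDiscreteSolution (φ : X → EReal) (P : TimePartition) (x₀ : X) (x : ℕ → X) : Prop :=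
  x 0 = x₀ ∧ ∀ k : ℕ, x (k + 1) ∈ resolventSet φ (P.t (k + 1) - P.t k) (x k)

/-- The piecewise constant interpolation: the value at `s` is `xᵏ` for the least `k` with
`s ≤ tᵏ`. -/
def interp (P : TimePartition) (x : ℕ → X) (s : ℝ≥0) : X :=
  x (sInf {k : ℕ | (s : ℝ) ≤ P.t k})

/-- `ξ` is the locally uniform limit, starting at `x₀`, of every sequence of interpolated discrete
solutions from `x₀` whose meshes tend to zero. -/
def IsLimitCurve (φ : X → EReal) (x₀ : X) (ξ : ℝ≥0 → X) : Prop :=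
  ξ 0 = x₀ ∧
  ∀ (P : ℕ → TimePartition) (x : ℕ → ℕ → X),
    Tendsto (fun i => (P i).mesh) atTop (𝓝 0) →
    (∀ i, IsDiscreteSolution φ (P i) x₀ (x i)) →
    ∀ T : ℝ≥0, TendstoUniformlyOn (fun i => interp (P i) (x i)) ξ atTop (Icc 0 T)

end GradFlow

end

noncomputable section

namespace GradFlow

/-! ### Trigonometric inequalities -/

/-! Everything rests on one discrete evolution variational inequality, `LocalEVI`: if z minimises φ
+ d²(x,·)/(2τ), then for all y with x, y, z mutually closer than r, d²(z,y) ≤ d²(x,y) + lτ d²(z,y) +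
2τ(φ(y) - φ(z)) + κ d²(x,z). It comes from testing the minimality of z along a geodesic from z to y
on which φ is convex, and from bounding the first variation of d²(x,·) there by d²(x,y) - d²(z,y),
up to a multiple of d²(x,z). In Case II commutativity moves the variation to the geodesic from z to
x, where K-convexity applies (`CaseII.exists_localEVI`). In Case I spherical comparison and a
trigonometric inequality give it directly with κ = 0, but only below the scale π/2
(`IsCAT1.localEVI`). If the diameter is less than π/2, coercivity follows from uniform convexity of
the squared distance (`IsCAT1.isCoercive`). From then on the two cases are one (`IsEvolutive`).

Two discrete solutions on different partitions are compared by doubling the time variable. For nodes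
i, j at nearly equal times, `gap` adds to d²(xⁱ,yʲ) a product of time difference and energy
difference, whose increment cancels the energy term of the variational inequality, and a multiple of
the mesh times the energies, whose decrease absorbs the errors. Hence each step multiplies `gap` by
at most an exponential factor (`gap_succ_le`); stepping back through touching intervals to (0,0)
gives `gap_le`. The same bound keeps the points close enough for the local inequality to stay
applicable.

The outcome is stability: the squared distance of two interpolations is at most M(d²(x₀,y₀) + δ) for
partitions with steps below δ (`IsEvolutive.exists_sq_dist_interp_le`). Equal starting points yield
a Cauchy property, hence the limit curve and its independence of all choices. Nearby starting points
yield the semigroup law, by restarting a discrete solution at a node. Continuity and invariance of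
the domain follow from the 1/2-Hölder bound and the energy decay of discrete solutions. -/

lemma mul_cos_le_sin {x : ℝ} (h0 : 0 ≤ x) (h1 : x ≤ Real.pi / 2) : x * Real.cos x ≤ Real.sin x := by
  rcases h1.eq_or_lt with rfl | h1
  · simp
  · have hc : 0 < Real.cos x := Real.cos_pos_of_mem_Ioo ⟨by linarith [Real.pi_pos], h1⟩
    have := Real.le_tan h0 h1
    rw [Real.tan_eq_sin_div_cos, le_div_iff₀ hc] at this
    exact this

/-- Monotonicity of sin u / u, written without division so that x = 0 is allowed. -/
lemma mul_sin_le_mul_sin {x y : ℝ} (h0 : 0 ≤ x) (hxy : x ≤ y) (h1 : y ≤ Real.pi / 2) :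
    x * Real.sin y ≤ y * Real.sin x := by
  obtain ⟨h, rfl⟩ : ∃ h, y = x + h := ⟨y - x, by ring⟩
  have hh : 0 ≤ h := by linarith
  rw [Real.sin_add]
  have hs : 0 ≤ Real.sin x := Real.sin_nonneg_of_nonneg_of_le_pi h0 (by linarith [Real.pi_pos])
  have hc : 0 ≤ Real.cos x := Real.cos_nonneg_of_mem_Icc ⟨by linarith [Real.pi_pos], by linarith⟩
  have e1 : x * Real.sin x * Real.cos h ≤ x * Real.sin x * 1 :=
    mul_le_mul_of_nonneg_left (Real.cos_le_one h) (mul_nonneg h0 hs)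
  have e2 : x * Real.cos x * Real.sin h ≤ x * Real.cos x * h :=
    mul_le_mul_of_nonneg_left (Real.sin_le hh) (mul_nonneg h0 hc)
  have e3 : h * (x * Real.cos x) ≤ h * Real.sin x :=
    mul_le_mul_of_nonneg_left (mul_cos_le_sin h0 (by linarith)) hh
  nlinarith

/-- The tangent line inequality at `cos b` for the convex function `u ↦ (arccos u) ^ 2`. -/
lemma sin_mul_sq_sub_sq_ge {b c : ℝ} (hb0 : 0 ≤ b) (hb1 : b ≤ Real.pi / 2) (hc0 : 0 ≤ c)
    (hc1 : c ≤ Real.pi / 2) :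
    2 * b * (Real.cos b - Real.cos c) ≤ Real.sin b * (c ^ 2 - b ^ 2) := by
  have hpi := Real.pi_pos
  rcases le_total b c with h | h
  -- With half sum p and half difference q, the claim is b sin p sin q ≤ p q sin b here, which
  -- follows from the monotonicity of sin u / u and sin q ≤ q. In the other case it is reversed, and
  -- the addition formula for sin (p + q) with u cos u ≤ sin u proves it.
  · obtain ⟨p, q, rfl, rfl⟩ : ∃ p q, b = p - q ∧ c = p + q :=
      ⟨(c + b) / 2, (c - b) / 2, by ring, by ring⟩
    have hq : 0 ≤ q := by linarith
    have hp : 0 ≤ p := by linarith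
    have e1 := mul_sin_le_mul_sin hb0 (show p - q ≤ p by linarith) (by linarith)
    have e2 : (p - q) * Real.sin p * Real.sin q ≤ p * Real.sin (p - q) * q :=
      mul_le_mul e1 (Real.sin_le hq)
        (Real.sin_nonneg_of_nonneg_of_le_pi hq (by linarith))
        (mul_nonneg hp (Real.sin_nonneg_of_nonneg_of_le_pi hb0 (by linarith)))
    have e3 : Real.cos (p - q) - Real.cos (p + q) = 2 * Real.sin p * Real.sin q := by
      rw [Real.cos_sub, Real.cos_add]; ring
    rw [e3]
    nlinarith
  · obtain ⟨p, q, rfl, rfl⟩ : ∃ p q, b = p + q ∧ c = p - q :=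
      ⟨(c + b) / 2, (b - c) / 2, by ring, by ring⟩
    have hq : 0 ≤ q := by linarith
    have hp : 0 ≤ p := by linarith
    have hsp := Real.sin_nonneg_of_nonneg_of_le_pi hp (by linarith)
    have hsq := Real.sin_nonneg_of_nonneg_of_le_pi hq (by linarith)
    have e3 : Real.cos (p + q) - Real.cos (p - q) = - (2 * Real.sin p * Real.sin q) := by
      rw [Real.cos_sub, Real.cos_add]; ring
    rw [e3, Real.sin_add]
    have e1 := mul_le_mul_of_nonneg_left (mul_cos_le_sin hq (by linarith)) (mul_nonneg hp hsp)
    have e2 := mul_le_mul_of_nonneg_left (mul_cos_le_sin hp (by linarith)) (mul_nonneg hq hsq)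
    nlinarith

/-- The spherical replacement of the Euclidean law of cosines used for the variational
inequality: `b, c` are sides of a small spherical triangle and `a` is the third one. -/
lemma mul_cos_mul_cos_sub_cos_le {a b c : ℝ} (ha0 : 0 ≤ a) (ha1 : a ≤ Real.pi / 2) (hb0 : 0 ≤ b)
    (hb1 : b ≤ Real.pi / 2) (hc0 : 0 ≤ c) (hc1 : c ≤ Real.pi / 2) :
    2 * a * b * (Real.cos a * Real.cos b - Real.cos c) ≤
      Real.sin a * Real.sin b * (c ^ 2 - b ^ 2) := by
  have hpi := Real.pi_pos
  have hsa := Real.sin_nonneg_of_nonneg_of_le_pi ha0 (by linarith)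
  have hcb : 0 ≤ Real.cos b := Real.cos_nonneg_of_mem_Icc ⟨by linarith, hb1⟩
  have hcc : 0 ≤ Real.cos c := Real.cos_nonneg_of_mem_Icc ⟨by linarith, hc1⟩
  -- It remains to compare a (cos a cos b - cos c) with sin a (cos b - cos c): a cos a ≤ sin a
  -- serves the first term and sin a ≤ a the second.
  have e0 := mul_le_mul_of_nonneg_left (sin_mul_sq_sub_sq_ge hb0 hb1 hc0 hc1) hsa
  have e1 := mul_le_mul_of_nonneg_left (mul_cos_le_sin ha0 ha1) (mul_nonneg hb0 hcb)
  have e2 := mul_le_mul_of_nonneg_left (Real.sin_le ha0) (mul_nonneg hb0 hcc)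
  nlinarith

/-! ### CAT(1)-spaces -/

section Inner

variable {E : Type*} [NormedAddCommGroup E] [InnerProductSpace ℝ E]

/-- The point of a great circle arc of length `u + v` at distance `u` from its origin `p`. -/
lemma sin_add_smul_eq_of_inner_eq_cos {p q w : E} {u v : ℝ} (hp : ‖p‖ = 1) (hq : ‖q‖ = 1)
    (hw : ‖w‖ = 1) (hpq : inner ℝ p q = Real.cos (u + v)) (hpw : inner ℝ p w = Real.cos u)
    (hwq : inner ℝ w q = Real.cos v) :
    Real.sin (u + v) • w = Real.sin v • p + Real.sin u • q := by
  rw [← sub_eq_zero, ← norm_eq_zero, ← sq_eq_zero_iff, ← real_inner_self_eq_norm_sq]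
  have hwp : inner ℝ w p = Real.cos u := by rw [real_inner_comm, hpw]
  have hqw : inner ℝ q w = Real.cos v := by rw [real_inner_comm, hwq]
  have hqp : inner ℝ q p = Real.cos (u + v) := by rw [real_inner_comm, hpq]
  have hpp : inner ℝ p p = (1 : ℝ) := by rw [real_inner_self_eq_norm_sq, hp, one_pow]
  have hqq : inner ℝ q q = (1 : ℝ) := by rw [real_inner_self_eq_norm_sq, hq, one_pow]
  have hww : inner ℝ w w = (1 : ℝ) := by rw [real_inner_self_eq_norm_sq, hw, one_pow]
  simp only [inner_sub_left, inner_sub_right, inner_add_left, inner_add_right,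
    real_inner_smul_left, real_inner_smul_right, hpp, hqq, hww, hpq, hpw, hwq, hwp, hqw, hqp]
  rw [Real.sin_add, Real.cos_add]
  have h1 := Real.sin_sq_add_cos_sq u
  have h2 := Real.sin_sq_add_cos_sq v
  have h1' : Real.cos u ^ 2 = 1 - Real.sin u ^ 2 := by linarith
  have h2' : Real.cos v ^ 2 = 1 - Real.sin v ^ 2 := by linarith
  ring_nf
  simp only [h1', h2']
  ring

end Inner

lemma inner_eq_cos_sphereDist (p q : S2) :
    inner ℝ (p : EuclideanSpace ℝ (Fin 3)) (q : EuclideanSpace ℝ (Fin 3)) =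
      Real.cos (sphereDist p q) := by
  have hp : ‖(p : EuclideanSpace ℝ (Fin 3))‖ = 1 := norm_eq_of_mem_sphere p
  have hq : ‖(q : EuclideanSpace ℝ (Fin 3))‖ = 1 := norm_eq_of_mem_sphere q
  rw [sphereDist, InnerProductGeometry.cos_angle, hp, hq]
  simp

variable {X : Type*} [MetricSpace X]

/-- The comparison inequality of CAT(1)-spaces, freed from the model space. -/
lemma IsCAT1.cos_dist_ge (hX : IsCAT1 X) {x y z : X} {γ : ℝ → X}
    (hper : dist x y + dist y z + dist z x < 2 * Real.pi) (hγ : IsMinGeodesic γ y z) {t : ℝ}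
    (ht : t ∈ Icc (0 : ℝ) 1) :
    Real.sin ((1 - t) * dist y z) * Real.cos (dist x y)
        + Real.sin (t * dist y z) * Real.cos (dist x z) ≤
      Real.sin (dist y z) * Real.cos (dist x (γ t)) := by
  obtain ⟨a, b, c, σ, hab, hbc, hca, ⟨hσ0, hσ1, hσ⟩, hle⟩ := hX.2 x y z γ hper hγ
  have hpi : dist y z ≤ Real.pi := by
    have := dist_triangle y x z
    rw [dist_comm y x, dist_comm x z] at this
    linarith
  have h0 : sphereDist b (σ t) = t * dist y z := by
    have := hσ 0 ⟨le_rfl, zero_le_one⟩ t ht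
    rw [hσ0, hbc] at this
    rw [this, zero_sub, abs_neg, abs_of_nonneg ht.1]
  have h1 : sphereDist (σ t) c = (1 - t) * dist y z := by
    have := hσ t ht 1 ⟨zero_le_one, le_rfl⟩
    rw [hσ1, hbc] at this
    rw [this, abs_sub_comm, abs_of_nonneg (by linarith [ht.2])]
  -- The comparison point is a linear combination of the endpoints b and c; pairing with a turns
  -- this into an identity between cosines of spherical distances.
  have key := sin_add_smul_eq_of_inner_eq_cos (p := (b : EuclideanSpace ℝ (Fin 3))) (q := c)
    (w := σ t) (u := t * dist y z) (v := (1 - t) * dist y z) (norm_eq_of_mem_sphere b)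
    (norm_eq_of_mem_sphere c) (norm_eq_of_mem_sphere (σ t))
    (by rw [inner_eq_cos_sphereDist, hbc]; congr 1; ring)
    (by rw [inner_eq_cos_sphereDist, h0]) (by rw [inner_eq_cos_sphereDist, h1])
  have key2 := congrArg (fun v => inner ℝ (a : EuclideanSpace ℝ (Fin 3)) v) key
  simp only [inner_add_right, real_inner_smul_right, inner_eq_cos_sphereDist] at key2
  have hac : sphereDist a c = dist x z := by
    rw [dist_comm, ← hca, sphereDist, sphereDist, InnerProductGeometry.angle_comm]
  rw [hab, hac, show t * dist y z + (1 - t) * dist y z = dist y z by ring] at key2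
  rw [← key2]
  refine mul_le_mul_of_nonneg_left ?_ (Real.sin_nonneg_of_nonneg_of_le_pi dist_nonneg hpi)
  exact Real.cos_le_cos_of_nonneg_of_le_pi dist_nonneg (InnerProductGeometry.angle_le_pi _ _)
    (hle t ht)

end GradFlow

end

noncomputable section

namespace GradFlow

variable {X : Type*}

/-! ### Real values of the functional -/

/-- The real value of `φ` on its domain. -/
def energy (φ : X → EReal) (x : X) : ℝ := (φ x).toReal

lemma coe_energy {φ : X → EReal} (hbot : ∀ x, φ x ≠ ⊥) {x : X} (hx : x ∈ dom φ) :
    ((energy φ x : ℝ) : EReal) = φ x :=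
  EReal.coe_toReal hx (hbot x)

variable [MetricSpace X]

lemma moreauYosida_le (φ : X → EReal) (τ : ℝ) (x w : X) :
    moreauYosida φ τ x ≤ φ w + ((dist x w ^ 2 / (2 * τ) : ℝ) : EReal) :=
  iInf_le (fun z => φ z + ((dist x z ^ 2 / (2 * τ) : ℝ) : EReal)) w

lemma mem_dom_of_mem_resolventSet {φ : X → EReal} (hbot : ∀ x, φ x ≠ ⊥) {τ : ℝ} {x z : X}
    (hx : x ∈ dom φ) (hz : z ∈ resolventSet φ τ x) : z ∈ dom φ := by
  intro htop
  have h1 := moreauYosida_le φ τ x x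
  have h2 : φ z + ((dist x z ^ 2 / (2 * τ) : ℝ) : EReal) = moreauYosida φ τ x := hz
  rw [← h2, htop, EReal.top_add_coe, ← coe_energy hbot hx, ← EReal.coe_add] at h1
  exact absurd h1 (not_le.2 (EReal.coe_lt_top _))

lemma energy_add_le_of_mem_resolventSet {φ : X → EReal} (hbot : ∀ x, φ x ≠ ⊥) {τ : ℝ} {x z w : X}
    (hx : x ∈ dom φ) (hz : z ∈ resolventSet φ τ x) (hw : w ∈ dom φ) :
    energy φ z + dist x z ^ 2 / (2 * τ) ≤ energy φ w + dist x w ^ 2 / (2 * τ) := by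
  have h1 := moreauYosida_le φ τ x w
  have h2 : φ z + ((dist x z ^ 2 / (2 * τ) : ℝ) : EReal) = moreauYosida φ τ x := hz
  rw [← h2, ← coe_energy hbot hw, ← coe_energy hbot (mem_dom_of_mem_resolventSet hbot hx hz)] at h1
  exact_mod_cast h1

lemma ConvexAlong.coe_bound {φ : X → EReal} (hbot : ∀ x, φ x ≠ ⊥) {lam : ℝ} {γ : ℝ → X}
    (h : ConvexAlong φ lam γ) (h0 : γ 0 ∈ dom φ) (h1 : γ 1 ∈ dom φ) {t : ℝ}
    (ht : t ∈ Icc (0 : ℝ) 1) :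
    φ (γ t) ≤ (((1 - t) * energy φ (γ 0) + t * energy φ (γ 1)
      - lam / 2 * (1 - t) * t * dist (γ 0) (γ 1) ^ 2 : ℝ) : EReal) := by
  have := h t ht
  rw [← coe_energy hbot h0, ← coe_energy hbot h1] at this
  exact_mod_cast this

lemma ConvexAlong.mem_dom {φ : X → EReal} (hbot : ∀ x, φ x ≠ ⊥) {lam : ℝ} {γ : ℝ → X}
    (h : ConvexAlong φ lam γ) (h0 : γ 0 ∈ dom φ) (h1 : γ 1 ∈ dom φ) {t : ℝ}
    (ht : t ∈ Icc (0 : ℝ) 1) : γ t ∈ dom φ :=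
  ne_top_of_le_ne_top (EReal.coe_ne_top _) (h.coe_bound hbot h0 h1 ht)

lemma ConvexAlong.energy_le {φ : X → EReal} (hbot : ∀ x, φ x ≠ ⊥) {lam : ℝ} {γ : ℝ → X}
    (h : ConvexAlong φ lam γ) (h0 : γ 0 ∈ dom φ) (h1 : γ 1 ∈ dom φ) {t : ℝ}
    (ht : t ∈ Icc (0 : ℝ) 1) :
    energy φ (γ t) ≤ (1 - t) * energy φ (γ 0) + t * energy φ (γ 1)
      - lam / 2 * (1 - t) * t * dist (γ 0) (γ 1) ^ 2 := by
  have := h.coe_bound hbot h0 h1 ht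
  rw [← coe_energy hbot (h.mem_dom hbot h0 h1 ht)] at this
  exact_mod_cast this

/-! ### The discrete evolution variational inequality -/

/-- The discrete evolution variational inequality for resolvents and test points that are within
distance `r` of each other. -/
def LocalEVI (φ : X → EReal) (l κ r : ℝ) : Prop :=
  ∀ τ : ℝ, 0 < τ → ∀ x ∈ dom φ, ∀ z ∈ resolventSet φ τ x, ∀ y ∈ dom φ,
    dist x y < r → dist z y < r → dist x z < r →
    dist z y ^ 2 ≤ dist x y ^ 2 + l * τ * dist z y ^ 2 + 2 * τ * (energy φ y - energy φ z)
      + κ * dist x z ^ 2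

/-- Comparing the resolvent with the points of a geodesic along which `φ` is convex. -/
lemma sq_dist_sub_sq_dist_le {φ : X → EReal} (hbot : ∀ x, φ x ≠ ⊥) {lam τ : ℝ} (hτ : 0 < τ)
    {x z : X} {γ : ℝ → X} (hx : x ∈ dom φ) (hz : z ∈ resolventSet φ τ x)
    (hγ : ConvexAlong φ lam γ) (h0 : γ 0 = z) (h1 : γ 1 ∈ dom φ) {s : ℝ} (hs : s ∈ Icc (0 : ℝ) 1) :
    dist x z ^ 2 - dist x (γ s) ^ 2 ≤
      s * (2 * τ * (energy φ (γ 1) - energy φ z - lam / 2 * (1 - s) * dist z (γ 1) ^ 2)) := by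
  have hzd : γ 0 ∈ dom φ := h0 ▸ mem_dom_of_mem_resolventSet hbot hx hz
  have e1 := energy_add_le_of_mem_resolventSet hbot hx hz (hγ.mem_dom hbot hzd h1 hs)
  have e2 := hγ.energy_le hbot hzd h1 hs
  rw [h0] at e2
  have e3 : dist x z ^ 2 / (2 * τ) - dist x (γ s) ^ 2 / (2 * τ) ≤
      s * (energy φ (γ 1) - energy φ z - lam / 2 * (1 - s) * dist z (γ 1) ^ 2) := by
    linarith
  rw [← sub_div, div_le_iff₀ (by positivity)] at e3
  linarith

lemma tendsto_convexity_bound (lam τ A b : ℝ) :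
    Tendsto (fun s : ℝ => 2 * τ * (A - lam / 2 * (1 - s) * b)) (𝓝[>] 0)
      (𝓝 (2 * τ * (A - lam / 2 * b))) := by
  have : Continuous (fun s : ℝ => 2 * τ * (A - lam / 2 * (1 - s) * b)) := by fun_prop
  have h := (this.tendsto 0).mono_left (nhdsWithin_le_nhds (s := Ioi 0))
  simpa using h

lemma eventually_mem_Icc_nhdsGT : ∀ᶠ s : ℝ in 𝓝[>] 0, 0 < s ∧ s ∈ Icc (0 : ℝ) 1 := by
  filter_upwards [Ioc_mem_nhdsGT (zero_lt_one (α := ℝ))] with s hs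
  exact ⟨hs.1, hs.1.le, hs.2⟩

lemma neg_mul_le_abs_mul (lam τ b : ℝ) (hτ : 0 < τ) (hb : 0 ≤ b) :
    -(lam * τ * b) ≤ |lam| * τ * b := by
  have := mul_le_mul_of_nonneg_right (neg_abs_le lam) (mul_nonneg hτ.le hb)
  nlinarith

lemma CaseII.exists_localEVI {φ : X → EReal} (hbot : ∀ x, φ x ≠ ⊥) {lam : ℝ} (h : CaseII φ lam) :
    ∃ l κ r : ℝ, 0 ≤ l ∧ 0 ≤ κ ∧ 0 < r ∧ LocalEVI φ l κ r := by
  obtain ⟨-, K, Γ, -, hjoin, hconv, hsq, hcomm⟩ := h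
  refine ⟨|lam|, |K| / 2, 1, abs_nonneg _, by positivity, one_pos, ?_⟩
  intro τ hτ x hx z hz y hy _ _ _
  have hzd := mem_dom_of_mem_resolventSet hbot hx hz
  obtain ⟨γ, hγ, hγ0, hγ1⟩ := hjoin z hzd y hy
  obtain ⟨η, hη, hη0, hη1⟩ := hjoin z hzd x hx
  obtain ⟨L, hL1, hL2⟩ := hcomm γ hγ η hη (hγ0.trans hη0.symm)
  have hcγ := hconv γ hγ (hγ0 ▸ hzd) (hγ1 ▸ hy)
  -- Minimality of z bounds the derivative of d²(x,·) along γ from below. By commutativity L is also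
  -- the derivative of d²(·,y) along η, which K-convexity bounds from above.
  have lower : -(2 * τ * (energy φ y - energy φ z - lam / 2 * dist z y ^ 2)) ≤ L := by
    refine le_of_tendsto_of_tendsto (tendsto_convexity_bound lam τ _ _).neg hL1 ?_
    filter_upwards [eventually_mem_Icc_nhdsGT] with s hs
    have e := sq_dist_sub_sq_dist_le hbot hτ hx hz hcγ hγ0 (hγ1 ▸ hy) hs.2
    rw [le_div_iff₀ hs.1, hη1, hγ0, dist_comm _ x, dist_comm _ x]
    rw [hγ1] at e
    linarith
  have upper : L ≤ dist x y ^ 2 - dist z y ^ 2 - K / 2 * dist x z ^ 2 := by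
    have ht : Tendsto (fun s : ℝ => dist x y ^ 2 - dist z y ^ 2 - K / 2 * (1 - s) * dist x z ^ 2)
        (𝓝[>] 0) (𝓝 (dist x y ^ 2 - dist z y ^ 2 - K / 2 * dist x z ^ 2)) := by
      have hc : Continuous
          (fun s : ℝ => dist x y ^ 2 - dist z y ^ 2 - K / 2 * (1 - s) * dist x z ^ 2) := by
        fun_prop
      simpa using (hc.tendsto 0).mono_left (nhdsWithin_le_nhds (s := Ioi 0))
    refine le_of_tendsto_of_tendsto hL2 ht ?_
    filter_upwards [eventually_mem_Icc_nhdsGT] with s hs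
    have e := hsq η hη y s hs.2
    rw [hη0, hη1, dist_comm z x] at e
    rw [div_le_iff₀ hs.1, hγ1, hη0]
    linarith
  have hK : -(K / 2 * dist x z ^ 2) ≤ |K| / 2 * dist x z ^ 2 := by
    have := mul_le_mul_of_nonneg_right (neg_abs_le K) (sq_nonneg (dist x z))
    linarith
  have hl := neg_mul_le_abs_mul lam τ (dist z y ^ 2) hτ (sq_nonneg _)
  linarith

lemma IsMinGeodesic.continuousWithinAt_zero {γ : ℝ → X} {y z : X} (h : IsMinGeodesic γ y z) :
    Tendsto γ (𝓝[>] 0) (𝓝 y) := by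
  rw [tendsto_iff_dist_tendsto_zero]
  have ht : Tendsto (fun s : ℝ => s * dist y z) (𝓝[>] 0) (𝓝 0) := by
    have hc : Continuous (fun s : ℝ => s * dist y z) := by fun_prop
    simpa using (hc.tendsto 0).mono_left (nhdsWithin_le_nhds (s := Ioi 0))
  refine ht.congr' ?_
  filter_upwards [eventually_mem_Icc_nhdsGT] with s hs
  have := h.2.2 s hs.2 0 ⟨le_rfl, zero_le_one⟩
  simp only [h.1] at this
  rw [this, sub_zero, abs_of_pos hs.1]

/-- In a CAT(1)-space the bracket bounds sin b (cos a - cos d(x,γ(s))) from above, so the limit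
controls the first variation along γ. -/
lemma tendsto_sin_slope (a b c : ℝ) :
    Tendsto (fun s : ℝ => s⁻¹ * ((Real.sin b - Real.sin ((1 - s) * b)) * Real.cos a
      - Real.sin (s * b) * Real.cos c)) (𝓝[>] 0)
      (𝓝 (b * (Real.cos a * Real.cos b - Real.cos c))) := by
  have h1 : HasDerivAt (fun s : ℝ => (1 - s) * b) (-b) 0 := by
    simpa using ((hasDerivAt_id (0 : ℝ)).const_sub 1).mul_const b
  have h2 : HasDerivAt (fun s : ℝ => s * b) b 0 := by
    simpa using (hasDerivAt_id (0 : ℝ)).mul_const b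
  have h3 := ((h1.sin.const_sub (Real.sin b)).mul_const (Real.cos a)).sub
    (h2.sin.mul_const (Real.cos c))
  have h4 := h3.tendsto_slope_zero_right
  simp only [zero_add, sub_zero, one_mul, zero_mul, Real.cos_zero, Real.sin_zero, sub_self,
    smul_eq_mul, Pi.sub_apply] at h4
  convert h4 using 2
  ring

lemma IsCAT1.localEVI (hX : IsCAT1 X) {φ : X → EReal} (hbot : ∀ x, φ x ≠ ⊥) {lam : ℝ}
    (hφ : IsLamConvex φ lam) : LocalEVI φ |lam| 0 (Real.pi / 2) := by
  intro τ hτ x hx z hz y hy hxy hzy hxz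
  have hpi := Real.pi_pos
  have hzd := mem_dom_of_mem_resolventSet hbot hx hz
  obtain ⟨γ, hγ, hcγ⟩ := hφ z hzd y hy
  have hγ0 := hγ.1
  have hγ1 := hγ.2.1
  have hl := neg_mul_le_abs_mul lam τ (dist z y ^ 2) hτ (sq_nonneg _)
  suffices h : -(2 * τ * (energy φ y - energy φ z - lam / 2 * dist z y ^ 2)) ≤
      dist x y ^ 2 - dist z y ^ 2 by linarith
  have comp : ∀ s ∈ Icc (0 : ℝ) 1, dist x z ^ 2 - dist x (γ s) ^ 2 ≤
      s * (2 * τ * (energy φ y - energy φ z - lam / 2 * (1 - s) * dist z y ^ 2)) := by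
    intro s hs
    have := sq_dist_sub_sq_dist_le hbot hτ hx hz hcγ hγ0 (hγ1 ▸ hy) hs
    rwa [hγ1] at this
  rcases (dist_nonneg (x := x) (y := z)).eq_or_lt with ha | ha
  · obtain rfl : x = z := dist_eq_zero.1 ha.symm
    rw [sub_self]
    have ht : Tendsto (fun s : ℝ => s * dist x y ^ 2) (𝓝[>] 0) (𝓝 0) := by
      have hc : Continuous (fun s : ℝ => s * dist x y ^ 2) := by fun_prop
      simpa using (hc.tendsto 0).mono_left (nhdsWithin_le_nhds (s := Ioi 0))
    refine le_of_tendsto_of_tendsto (tendsto_convexity_bound lam τ _ _).neg ht ?_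
    filter_upwards [eventually_mem_Icc_nhdsGT] with s hs
    have e := comp s hs.2
    have e2 : dist x (γ s) = s * dist x y := by
      have := hγ.2.2 0 ⟨le_rfl, zero_le_one⟩ s hs.2
      simp only [hγ0] at this
      rw [this, zero_sub, abs_neg, abs_of_pos hs.1]
    rw [e2, dist_self] at e
    refine le_of_mul_le_mul_left ?_ hs.1
    nlinarith
  rcases (dist_nonneg (x := z) (y := y)).eq_or_lt with hb | hb
  · obtain rfl : z = y := dist_eq_zero.1 hb.symm
    simp
  have hsa : 0 < Real.sin (dist x z) := Real.sin_pos_of_pos_of_lt_pi ha (by linarith)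
  have hsb : 0 < Real.sin (dist z y) := Real.sin_pos_of_pos_of_lt_pi hb (by linarith)
  have hDt : Tendsto (fun s => dist x (γ s)) (𝓝[>] 0) (𝓝 (dist x z)) :=
    tendsto_const_nhds.dist hγ.continuousWithinAt_zero
  -- The distance D(s) = d(x,γ(s)) need not be differentiable at 0. The tangent line inequality at
  -- cos D(s) bounds sin D (D² - a²) by 2D (cos a - cos D), comparison bounds the latter by an
  -- explicit function of s, and only that function is differentiated.
  have lim : -(2 * τ * (energy φ y - energy φ z - lam / 2 * dist z y ^ 2)) *
      (Real.sin (dist x z) * Real.sin (dist z y)) ≤ 2 * dist x z *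
        (dist z y * (Real.cos (dist x z) * Real.cos (dist z y) - Real.cos (dist x y))) := by
    refine le_of_tendsto_of_tendsto ((tendsto_convexity_bound lam τ _ _).neg.mul
      (((Real.continuous_sin.tendsto _).comp hDt).mul_const _))
      ((hDt.const_mul 2).mul (tendsto_sin_slope (dist x z) (dist z y) (dist x y))) ?_
    filter_upwards [eventually_mem_Icc_nhdsGT, hDt.eventually_lt_const hxz] with s hs hD
    simp only [Function.comp_apply]
    have e := comp s hs.2
    have hsD := Real.sin_nonneg_of_nonneg_of_le_pi (dist_nonneg (x := x) (y := γ s)) (by linarith)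
    have e1 := sin_mul_sq_sub_sq_ge (dist_nonneg (x := x) (y := γ s)) hD.le ha.le hxz.le
    have e2 := hX.cos_dist_ge (x := x) (by rw [dist_comm y x]; linarith) hγ hs.2
    have e3 := mul_le_mul_of_nonneg_left e2 (mul_nonneg zero_le_two (dist_nonneg (x := x) (y := γ s)))
    have e4 := mul_le_mul_of_nonneg_left e (mul_nonneg hsD hsb.le)
    have e5 := mul_le_mul_of_nonneg_left e1 hsb.le
    refine le_of_mul_le_mul_left ?_ hs.1
    have e6 : ∀ u v : ℝ, s * (u * (s⁻¹ * v)) = u * v := by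
      intro u v; field_simp [hs.1.ne']
    rw [e6]
    nlinarith
  have fin := mul_cos_mul_cos_sub_cos_le ha.le hxz.le hb.le hzy.le
    (dist_nonneg (x := x) (y := y)) hxy.le
  refine le_of_mul_le_mul_left ?_ (mul_pos hsa hsb)
  linarith

end GradFlow

end

noncomputable section

namespace GradFlow

variable {X : Type*} [MetricSpace X] {φ : X → EReal}

/-! ### Coercivity on spaces of small diameter -/

lemma mem_dom_and_energy_le_of_tendsto (hbot : ∀ x, φ x ≠ ⊥) (hlsc : LowerSemicontinuous φ)
    {w : ℕ → X} {x : X} {C : ℝ} (hw : Tendsto w atTop (𝓝 x))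
    (h : ∀ᶠ n in atTop, w n ∈ dom φ ∧ energy φ (w n) ≤ C) : x ∈ dom φ ∧ energy φ x ≤ C := by
  have h1 : x ∈ φ ⁻¹' Iic ((C : ℝ) : EReal) := by
    refine (hlsc.isClosed_preimage _).mem_of_tendsto hw ?_
    filter_upwards [h] with n hn
    rw [mem_preimage, mem_Iic, ← coe_energy hbot hn.1]
    exact_mod_cast hn.2
  have h2 : x ∈ dom φ := ne_top_of_le_ne_top (EReal.coe_ne_top _) h1
  refine ⟨h2, ?_⟩
  rw [mem_preimage, mem_Iic, ← coe_energy hbot h2] at h1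
  exact_mod_cast h1

lemma moreauYosida_ne_bot_and_mem_resolventSet (hbot : ∀ x, φ x ≠ ⊥) {τ : ℝ} {x w : X}
    (hw : w ∈ dom φ)
    (h : ∀ z ∈ dom φ, energy φ w + dist x w ^ 2 / (2 * τ) ≤ energy φ z + dist x z ^ 2 / (2 * τ)) :
    moreauYosida φ τ x ≠ ⊥ ∧ w ∈ resolventSet φ τ x := by
  have heq : φ w + ((dist x w ^ 2 / (2 * τ) : ℝ) : EReal) = moreauYosida φ τ x := by
    refine le_antisymm (le_iInf fun z => ?_) (moreauYosida_le φ τ x w)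
    by_cases hz : z ∈ dom φ
    · rw [← coe_energy hbot hw, ← coe_energy hbot hz]
      exact_mod_cast h z hz
    · have : φ z = ⊤ := not_not.1 hz
      rw [this, EReal.top_add_coe]
      exact le_top
  refine ⟨?_, heq⟩
  rw [← heq, ← coe_energy hbot hw, ← EReal.coe_add]
  exact EReal.coe_ne_bot _

/-- Uniform convexity of the squared distance at midpoints. -/
lemma IsCAT1.sq_dist_midpoint_le (hX : IsCAT1 X) {R : ℝ} (hR : R < Real.pi / 2)
    (hd : ∀ x y : X, dist x y ≤ R) {x y z : X} {γ : ℝ → X} (hγ : IsMinGeodesic γ y z) :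
    dist x (γ (1 / 2)) ^ 2 ≤ (dist x y ^ 2 + dist x z ^ 2) / 2
      - Real.cos R / Real.pi ^ 2 * dist y z ^ 2 := by
  have hpi := Real.pi_pos
  have hpi2 : 4 ≤ Real.pi ^ 2 := by nlinarith [Real.two_le_pi]
  have hR0 : 0 ≤ R := dist_nonneg.trans (hd x x)
  have hcR : 0 < Real.cos R := Real.cos_pos_of_mem_Ioo ⟨by linarith, hR⟩
  set W := Real.cos R / Real.pi ^ 2 * dist y z ^ 2 with hW
  have hW0 : 0 ≤ W := by positivity
  rcases (dist_nonneg (x := y) (y := z)).eq_or_lt with hb | hb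
  · obtain rfl : y = z := dist_eq_zero.1 hb.symm
    have h1 := hγ.2.2 (1 / 2) ⟨by norm_num, by norm_num⟩ 0 ⟨le_rfl, zero_le_one⟩
    simp only [hγ.1, dist_self, mul_zero] at h1
    rw [dist_eq_zero.1 h1, hW, dist_self]
    simp
  rcases (dist_nonneg (x := x) (y := γ (1 / 2))).eq_or_lt with hD | hD
  · rw [← hD]
    have htri : dist y z ≤ dist x y + dist x z := by
      have := dist_triangle y x z
      rwa [dist_comm y x] at this
    have h1 : W ≤ 1 / 4 * dist y z ^ 2 := by
      refine mul_le_mul_of_nonneg_right ?_ (sq_nonneg _)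
      rw [div_le_iff₀ (by positivity)]
      linarith [Real.cos_le_one R]
    have h2 : dist y z ^ 2 ≤ (dist x y + dist x z) ^ 2 := pow_le_pow_left₀ dist_nonneg htri 2
    nlinarith [sq_nonneg (dist x y - dist x z)]
  have hc := hX.cos_dist_ge (x := x) (t := 1 / 2)
    (by linarith [hd x y, hd y z, hd z x]) hγ ⟨by norm_num, by norm_num⟩
  have hhalf : (1 - 1 / 2 : ℝ) * dist y z = dist y z / 2 := by ring
  have hhalf' : (1 / 2 : ℝ) * dist y z = dist y z / 2 := by ring
  have hsin : Real.sin (dist y z) = 2 * Real.sin (dist y z / 2) * Real.cos (dist y z / 2) := by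
    rw [← Real.sin_two_mul]; congr 1; ring
  rw [hhalf, hhalf', hsin] at hc
  have hyz := hd y z
  have hs : 0 < Real.sin (dist y z / 2) :=
    Real.sin_pos_of_pos_of_lt_pi (by linarith) (by linarith)
  have hc' : Real.cos (dist x y) + Real.cos (dist x z) ≤
      2 * Real.cos (dist y z / 2) * Real.cos (dist x (γ (1 / 2))) := by
    refine le_of_mul_le_mul_left ?_ hs
    linarith
  set D := dist x (γ (1 / 2)) with hDdef
  have hDR : D ≤ R := hd _ _
  -- The sum of the tangent line inequalities at D bounds 2D(2 cos D - cos d(x,y) - cos d(x,z)); by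
  -- the median inequality `hc'` this is at least 4D cos D (1 - cos (d(y,z)/2)). The constant cos R
  -- / π² comes from cos u ≤ 1 - 2u²/π².
  have t1 := sin_mul_sq_sub_sq_ge hD.le (hDR.trans hR.le) (dist_nonneg (x := x) (y := y))
    ((hd x y).trans hR.le)
  have t2 := sin_mul_sq_sub_sq_ge hD.le (hDR.trans hR.le) (dist_nonneg (x := x) (y := z))
    ((hd x z).trans hR.le)
  have hcb : Real.cos (dist y z / 2) ≤ 1 - 2 / Real.pi ^ 2 * (dist y z / 2) ^ 2 :=
    Real.cos_le_one_sub_mul_cos_sq (by rw [abs_of_pos (by linarith)]; linarith)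
  have hcD : Real.cos R ≤ Real.cos D :=
    Real.cos_le_cos_of_nonneg_of_le_pi hD.le (by linarith) hDR
  have h3 : W ≤ 2 * Real.cos D * (1 - Real.cos (dist y z / 2)) := by
    have h4 : 2 / Real.pi ^ 2 * (dist y z / 2) ^ 2 ≤ 1 - Real.cos (dist y z / 2) := by linarith
    calc W = 2 * Real.cos R * (2 / Real.pi ^ 2 * (dist y z / 2) ^ 2) := by
          rw [hW]; field_simp
      _ ≤ _ := mul_le_mul (by linarith) h4 (by positivity) (by linarith)
  have h5 : 2 * D * W ≤ Real.sin D * (dist x y ^ 2 + dist x z ^ 2 - 2 * D ^ 2) := by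
    have h6 := mul_le_mul_of_nonneg_left hc' (show 0 ≤ 2 * D by linarith)
    have h7 := mul_le_mul_of_nonneg_left h3 (show 0 ≤ 2 * D by linarith)
    linarith
  have hsD : 0 < Real.sin D := Real.sin_pos_of_pos_of_lt_pi hD (by linarith)
  have hQ : 0 ≤ dist x y ^ 2 + dist x z ^ 2 - 2 * D ^ 2 :=
    nonneg_of_mul_nonneg_right (le_trans (by positivity) h5) hsD
  have h8 := h5.trans (mul_le_mul_of_nonneg_right (Real.sin_le hD.le) hQ)
  have h9 : 2 * W ≤ dist x y ^ 2 + dist x z ^ 2 - 2 * D ^ 2 := by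
    refine le_of_mul_le_mul_left ?_ hD
    linarith
  linarith

/-- Semicontinuity bounds φ from below near o. A very negative value at y would, by convexity, pull
φ below that bound at parameter t on a geodesic from o, a point still within ρ of o because the
diameter is bounded. -/
lemma IsLamConvex.exists_energy_ge (hbot : ∀ x, φ x ≠ ⊥) (hdom : (dom φ).Nonempty)
    (hlsc : LowerSemicontinuous φ) {lam : ℝ} (hφ : IsLamConvex φ lam) {R : ℝ}
    (hd : ∀ x y : X, dist x y ≤ R) : ∃ B : ℝ, ∀ y ∈ dom φ, B ≤ energy φ y := by
  obtain ⟨o, ho⟩ := hdom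
  have hR0 : 0 ≤ R := dist_nonneg.trans (hd o o)
  have hlt : ((energy φ o - 1 : ℝ) : EReal) < φ o := by
    rw [← coe_energy hbot ho]
    exact_mod_cast sub_one_lt _
  obtain ⟨ρ, hρ, hball⟩ := Metric.eventually_nhds_iff.1 (hlsc o _ hlt)
  set t := ρ / (ρ + R + 1) with htdef
  have hden : 0 < ρ + R + 1 := by positivity
  have ht0 : 0 < t := by positivity
  have ht1 : t ≤ 1 := by rw [htdef, div_le_one hden]; linarith
  have htR : t * R < ρ := by
    rw [htdef, div_mul_eq_mul_div, div_lt_iff₀ hden]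
    nlinarith
  refine ⟨energy φ o - (1 + |lam| * R ^ 2) / t, fun y hy => ?_⟩
  obtain ⟨γ, hγ, hc⟩ := hφ o ho y hy
  have hmem : t ∈ Icc (0 : ℝ) 1 := ⟨ht0.le, ht1⟩
  have h0 : γ 0 ∈ dom φ := by rw [hγ.1]; exact ho
  have h1 : γ 1 ∈ dom φ := by rw [hγ.2.1]; exact hy
  have hdt : dist (γ t) o < ρ := by
    have := hγ.2.2 t hmem 0 ⟨le_rfl, zero_le_one⟩
    simp only [hγ.1] at this
    rw [this, sub_zero, abs_of_pos ht0]
    exact lt_of_le_of_lt (mul_le_mul_of_nonneg_left (hd o y) ht0.le) htR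
  have e1 : ((energy φ o - 1 : ℝ) : EReal) < φ (γ t) := hball hdt
  rw [← coe_energy hbot (hc.mem_dom hbot h0 h1 hmem)] at e1
  have e2 : energy φ o - 1 < energy φ (γ t) := by exact_mod_cast e1
  have e3 := hc.energy_le hbot h0 h1 hmem
  rw [hγ.1, hγ.2.1] at e3
  have e4 : |lam / 2 * (1 - t) * t * dist o y ^ 2| ≤ |lam| * R ^ 2 := by
    rw [abs_mul, abs_mul, abs_mul, abs_div, abs_of_pos ht0, abs_of_nonneg (sub_nonneg.2 ht1),
      abs_of_nonneg (sq_nonneg (dist o y)), abs_of_pos (zero_lt_two (α := ℝ))]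
    refine mul_le_mul ?_ (pow_le_pow_left₀ dist_nonneg (hd o y) 2) (sq_nonneg _) (abs_nonneg _)
    have : (1 - t) * t ≤ 1 := by nlinarith
    have := mul_le_mul_of_nonneg_left this (abs_nonneg lam)
    nlinarith [abs_nonneg lam, mul_nonneg (abs_nonneg lam) (mul_nonneg (sub_nonneg.2 ht1) ht0.le)]
  have e5 := (abs_le.1 e4).1
  rw [sub_le_iff_le_add, ← sub_le_iff_le_add', le_div_iff₀ ht0]
  linarith

lemma IsCAT1.isCoercive [CompleteSpace X] (hX : IsCAT1 X) (hbot : ∀ x, φ x ≠ ⊥)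
    (hdom : (dom φ).Nonempty) (hlsc : LowerSemicontinuous φ) {lam : ℝ} (hφ : IsLamConvex φ lam)
    (hdiam : Metric.ediam (univ : Set X) < ENNReal.ofReal (Real.pi / 2)) : IsCoercive φ := by
  have hpi := Real.pi_pos
  have hne : Metric.ediam (univ : Set X) ≠ ⊤ := (hdiam.trans ENNReal.ofReal_lt_top).ne
  set R := (Metric.ediam (univ : Set X)).toReal with hRdef
  have hR : R < Real.pi / 2 := (ENNReal.lt_ofReal_iff_toReal_lt hne).1 hdiam
  have hd : ∀ x y : X, dist x y ≤ R := by
    intro x y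
    rw [dist_edist]
    exact ENNReal.toReal_mono hne (Metric.edist_le_ediam_of_mem (mem_univ x) (mem_univ y))
  obtain ⟨B, hB⟩ := hφ.exists_energy_ge hbot hdom hlsc hd
  have hR0 : 0 ≤ R := ENNReal.toReal_nonneg
  have hcR : 0 < Real.cos R := Real.cos_pos_of_mem_Ioo ⟨by linarith, hR⟩
  set k := Real.cos R / Real.pi ^ 2 with hk
  have hk0 : 0 < k := by positivity
  -- At midpoints φ may lose |lam|/8 times the squared distance, while d²(x,·)/(2τ) gains k/(2τ)
  -- times it. Below this threshold the net gain is at least 1, which makes minimising sequences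
  -- Cauchy.
  refine ⟨k / (2 * (|lam| / 8 + 1)), by positivity, fun τ hτ hτs x => ?_⟩
  have hkτ : |lam| / 8 + 1 ≤ k / (2 * τ) := by
    rw [lt_div_iff₀ (by positivity)] at hτs
    rw [le_div_iff₀ (by positivity)]
    linarith
  set Ψ : X → ℝ := fun w => energy φ w + dist x w ^ 2 / (2 * τ) with hΨ
  have hbdd : BddBelow (Ψ '' dom φ) := by
    refine ⟨B, ?_⟩
    rintro _ ⟨w, hw, rfl⟩
    have := hB w hw
    have : 0 ≤ dist x w ^ 2 / (2 * τ) := by positivity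
    simp only [hΨ]
    linarith
  set I := sInf (Ψ '' dom φ) with hI
  have hIle : ∀ w ∈ dom φ, I ≤ Ψ w := fun w hw => csInf_le hbdd (mem_image_of_mem Ψ hw)
  have hunif : ∀ y ∈ dom φ, ∀ z ∈ dom φ, dist y z ^ 2 ≤ (Ψ y + Ψ z) / 2 - I := by
    intro y hy z hz
    obtain ⟨γ, hγ, hc⟩ := hφ y hy z hz
    have hmem : (1 / 2 : ℝ) ∈ Icc (0 : ℝ) 1 := ⟨by norm_num, by norm_num⟩
    have h0 : γ 0 ∈ dom φ := by rw [hγ.1]; exact hy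
    have h1 : γ 1 ∈ dom φ := by rw [hγ.2.1]; exact hz
    have e1 := hIle _ (hc.mem_dom hbot h0 h1 hmem)
    have e2 := hc.energy_le hbot h0 h1 hmem
    rw [hγ.1, hγ.2.1] at e2
    have e3 := div_le_div_of_nonneg_right (hX.sq_dist_midpoint_le hR hd (x := x) hγ)
      (show 0 ≤ 2 * τ by positivity)
    have e4 : ((dist x y ^ 2 + dist x z ^ 2) / 2 - k * dist y z ^ 2) / (2 * τ) =
        (dist x y ^ 2 / (2 * τ) + dist x z ^ 2 / (2 * τ)) / 2 - k / (2 * τ) * dist y z ^ 2 := by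
      ring
    rw [← hk, e4] at e3
    have e5 := mul_le_mul_of_nonneg_right hkτ (sq_nonneg (dist y z))
    have e6 := mul_le_mul_of_nonneg_right (neg_abs_le lam) (sq_nonneg (dist y z))
    simp only [hΨ] at e1 ⊢
    linarith
  have hex : ∀ n : ℕ, ∃ w ∈ dom φ, Ψ w < I + 1 / ((n : ℝ) + 1) := by
    intro n
    obtain ⟨_, ⟨w, hw, rfl⟩, hlt⟩ := exists_lt_of_csInf_lt (hdom.image Ψ)
      (show sInf (Ψ '' dom φ) < I + 1 / ((n : ℝ) + 1) from lt_add_of_pos_right _ (by positivity))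
    exact ⟨w, hw, hlt⟩
  choose w hwd hwI using hex
  have hlim0 : Tendsto (fun n : ℕ => 1 / ((n : ℝ) + 1)) atTop (𝓝 0) :=
    tendsto_one_div_add_atTop_nhds_zero_nat
  have hcauchy : CauchySeq w := by
    refine cauchySeq_of_le_tendsto_0 (fun N : ℕ => √(1 / ((N : ℝ) + 1))) ?_ ?_
    · intro n m N hn hm
      refine Real.le_sqrt_of_sq_le ((hunif _ (hwd n) _ (hwd m)).trans ?_)
      have h1 : 1 / ((n : ℝ) + 1) ≤ 1 / ((N : ℝ) + 1) :=
        one_div_le_one_div_of_le (by positivity) (by exact_mod_cast Nat.succ_le_succ hn)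
      have h2 : 1 / ((m : ℝ) + 1) ≤ 1 / ((N : ℝ) + 1) :=
        one_div_le_one_div_of_le (by positivity) (by exact_mod_cast Nat.succ_le_succ hm)
      linarith [hwI n, hwI m]
    · have := (Real.continuous_sqrt.tendsto 0).comp hlim0
      rwa [Real.sqrt_zero] at this
  obtain ⟨v, hv⟩ := cauchySeq_tendsto_of_complete hcauchy
  have hdv : Tendsto (fun n => dist x (w n) ^ 2 / (2 * τ)) atTop (𝓝 (dist x v ^ 2 / (2 * τ))) :=
    ((tendsto_const_nhds.dist hv).pow 2).div_const _
  have hv2 : ∀ ε > 0, v ∈ dom φ ∧ energy φ v ≤ I + ε - dist x v ^ 2 / (2 * τ) := by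
    intro ε hε
    refine mem_dom_and_energy_le_of_tendsto hbot hlsc hv ?_
    filter_upwards [hdv.eventually_const_lt (sub_lt_self _ (half_pos hε)),
      hlim0.eventually_lt_const (half_pos hε)] with n h1 h2
    refine ⟨hwd n, ?_⟩
    have := hwI n
    simp only [hΨ] at this
    linarith
  have hvd := (hv2 1 one_pos).1
  have hvI : Ψ v ≤ I := by
    refine le_of_forall_pos_le_add fun ε hε => ?_
    have := (hv2 ε hε).2
    simp only [hΨ]
    linarith
  obtain ⟨h1, h2⟩ := moreauYosida_ne_bot_and_mem_resolventSet hbot (τ := τ) (x := x) hvd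
    (fun z hz => hvI.trans (hIle z hz))
  exact ⟨h1, v, h2⟩

end GradFlow

end

noncomputable section

namespace GradFlow

/-! ### Discrete solutions -/

/-- The implicit Gronwall step. -/
lemma le_exp_mul_of_le_add_mul {a b u : ℝ} (hu : 0 ≤ u) (hu2 : u ≤ 1 / 2) (ha : 0 ≤ a)
    (h : a ≤ b + u * a) : a ≤ Real.exp (2 * u) * b := by
  have h1 : 1 ≤ (1 + 2 * u) * (1 - u) := by nlinarith
  have h2 : 1 + 2 * u ≤ Real.exp (2 * u) := by linarith [Real.add_one_le_exp (2 * u)]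
  have hb : (1 - u) * a ≤ b := by linarith
  have hb0 : 0 ≤ b := le_trans (mul_nonneg (by linarith) ha) hb
  calc a ≤ (1 + 2 * u) * (1 - u) * a := le_mul_of_one_le_left ha h1
    _ = (1 + 2 * u) * ((1 - u) * a) := by ring
    _ ≤ (1 + 2 * u) * b := mul_le_mul_of_nonneg_left hb (by linarith)
    _ ≤ Real.exp (2 * u) * b := mul_le_mul_of_nonneg_right h2 hb0

namespace TimePartition

lemma step_pos (P : TimePartition) (k : ℕ) : 0 < P.t (k + 1) - P.t k :=
  sub_pos.2 (P.strictMono k.lt_succ_self)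

lemma step_lt_of_mesh_lt {P : TimePartition} {δ : ℝ} (h : P.mesh < ENNReal.ofReal δ) (k : ℕ) :
    P.t (k + 1) - P.t k < δ := by
  have h1 : ENNReal.ofReal (P.t (k + 1) - P.t k) < ENNReal.ofReal δ :=
    lt_of_le_of_lt (le_iSup (fun k : ℕ => ENNReal.ofReal (P.t (k + 1) - P.t k)) k) h
  exact (ENNReal.ofReal_lt_ofReal_iff_of_nonneg (P.step_pos k).le).1 h1

lemma t_nonneg (P : TimePartition) (k : ℕ) : 0 ≤ P.t k := by
  rw [← P.t_zero]
  exact P.strictMono.monotone (Nat.zero_le k)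

/-- The index of the node that carries the value of interpolations at time `s`. -/
def index (P : TimePartition) (s : ℝ≥0) : ℕ := sInf {k : ℕ | (s : ℝ) ≤ P.t k}

lemma le_t_index (P : TimePartition) (s : ℝ≥0) : (s : ℝ) ≤ P.t (P.index s) := by
  have hne : {k : ℕ | (s : ℝ) ≤ P.t k}.Nonempty :=
    (P.tendsto.eventually_ge_atTop (s : ℝ)).exists
  exact Nat.sInf_mem hne

lemma t_lt_of_index_eq_succ {P : TimePartition} {s : ℝ≥0} {k : ℕ} (h : P.index s = k + 1) :
    P.t k < s := by
  by_contra hk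
  have : P.index s ≤ k := Nat.sInf_le (not_lt.1 hk)
  omega

lemma t_index_lt {P : TimePartition} {δ : ℝ} (hδ0 : 0 < δ) (hδ : ∀ k, P.t (k + 1) - P.t k < δ)
    (s : ℝ≥0) : P.t (P.index s) < s + δ := by
  rcases hk : P.index s with _ | k
  · rw [P.t_zero]
    have := s.2
    positivity
  · linarith [hδ k, t_lt_of_index_eq_succ hk]

lemma index_mono (P : TimePartition) {s s' : ℝ≥0} (h : s ≤ s') : P.index s ≤ P.index s' :=
  Nat.sInf_le (le_trans (NNReal.coe_le_coe.2 h) (P.le_t_index s'))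

@[simp] lemma index_zero (P : TimePartition) : P.index 0 = 0 :=
  Nat.le_zero.1 (Nat.sInf_le (by simp [P.t_zero]))

end TimePartition

variable {X : Type*} [MetricSpace X] {φ : X → EReal} {P Q : TimePartition} {x₀ y₀ : X}
  {x y : ℕ → X}

lemma IsDiscreteSolution.mem_dom (hbot : ∀ x, φ x ≠ ⊥) (hx₀ : x₀ ∈ dom φ)
    (h : IsDiscreteSolution φ P x₀ x) (k : ℕ) : x k ∈ dom φ := by
  induction k with
  | zero => rw [h.1]; exact hx₀
  | succ k ih => exact mem_dom_of_mem_resolventSet hbot ih (h.2 k)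

lemma IsDiscreteSolution.sq_dist_succ_le (hbot : ∀ x, φ x ≠ ⊥) (hx₀ : x₀ ∈ dom φ)
    (h : IsDiscreteSolution φ P x₀ x) (k : ℕ) :
    dist (x k) (x (k + 1)) ^ 2 ≤
      2 * (P.t (k + 1) - P.t k) * (energy φ (x k) - energy φ (x (k + 1))) := by
  have hk := h.mem_dom hbot hx₀ k
  have e := energy_add_le_of_mem_resolventSet hbot hk (h.2 k) hk
  have hp := P.step_pos k
  rw [dist_self, zero_pow two_ne_zero, zero_div, add_zero] at e
  have e2 : dist (x k) (x (k + 1)) ^ 2 / (2 * (P.t (k + 1) - P.t k)) ≤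
    energy φ (x k) - energy φ (x (k + 1)) := by linarith
  rw [div_le_iff₀ (by positivity)] at e2
  linarith

lemma IsDiscreteSolution.energy_antitone (hbot : ∀ x, φ x ≠ ⊥) (hx₀ : x₀ ∈ dom φ)
    (h : IsDiscreteSolution φ P x₀ x) : Antitone (fun k => energy φ (x k)) := by
  refine antitone_nat_of_succ_le fun k => ?_
  have e := (sq_nonneg _).trans (h.sq_dist_succ_le hbot hx₀ k)
  have hp := P.step_pos k
  have := nonneg_of_mul_nonneg_right e (by positivity)
  linarith

lemma add_sq_le_of_sq_le {u v A α τ β : ℝ} (hA : 0 ≤ A)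
    (hα : 0 ≤ α) (hτ : 0 ≤ τ) (hβ : 0 ≤ β) (h1 : u ^ 2 ≤ 2 * A * α) (h2 : v ^ 2 ≤ 2 * τ * β) :
    (u + v) ^ 2 ≤ 2 * (A + τ) * (α + β) := by
  have h3 : (u * v) ^ 2 ≤ (A * β + τ * α) ^ 2 := by
    calc (u * v) ^ 2 = u ^ 2 * v ^ 2 := by ring
      _ ≤ (2 * A * α) * (2 * τ * β) := mul_le_mul h1 h2 (sq_nonneg _) (by positivity)
      _ ≤ (A * β + τ * α) ^ 2 := by nlinarith [sq_nonneg (A * β - τ * α)]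
  have h4 := abs_le_of_sq_le_sq' h3 (by positivity)
  nlinarith [h4.2]

/-- Discrete solutions are Hölder continuous with exponent `1/2`. -/
lemma IsDiscreteSolution.sq_dist_le (hbot : ∀ x, φ x ≠ ⊥) (hx₀ : x₀ ∈ dom φ)
    (h : IsDiscreteSolution φ P x₀ x) {i k : ℕ} (hik : i ≤ k) :
    dist (x i) (x k) ^ 2 ≤ 2 * (P.t k - P.t i) * (energy φ (x i) - energy φ (x k)) := by
  induction k, hik using Nat.le_induction with
  | base => simp
  | succ k hik ih =>
    have h1 := h.sq_dist_succ_le hbot hx₀ k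
    have h2 := P.strictMono.monotone hik
    have h3 := h.energy_antitone hbot hx₀ hik
    have h4 := h.energy_antitone hbot hx₀ (Nat.le_succ k)
    simp only [Nat.succ_eq_add_one] at h3 h4
    have h5 := add_sq_le_of_sq_le (sub_nonneg.2 h2) (sub_nonneg.2 h3) (P.step_pos k).le
      (sub_nonneg.2 h4) ih h1
    calc dist (x i) (x (k + 1)) ^ 2 ≤ (dist (x i) (x k) + dist (x k) (x (k + 1))) ^ 2 :=
          pow_le_pow_left₀ dist_nonneg (dist_triangle _ _ _) 2
      _ ≤ _ := h5
      _ = _ := by ring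

/-- A priori estimate: the energy of discrete solutions is bounded from below on bounded time
intervals. -/
lemma IsDiscreteSolution.energy_ge (hbot : ∀ x, φ x ≠ ⊥) (hx₀ : x₀ ∈ dom φ)
    (h : IsDiscreteSolution φ P x₀ x) {o : X} {A τ₁ T C R : ℝ} (hτ₁ : 0 < τ₁)
    (hlow : ∀ z ∈ dom φ, -A ≤ energy φ z + dist o z ^ 2 / (2 * τ₁))
    (hP : ∀ k, P.t (k + 1) - P.t k < τ₁ / 8) (hC : energy φ x₀ ≤ C) (hR : dist o x₀ ≤ R) {n : ℕ}
    (hn : P.t n ≤ T) :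
    -(A + Real.exp (8 / τ₁ * T) * (R ^ 2 + τ₁ * (C + A)) / τ₁) ≤ energy φ (x n) := by
  -- The quadratic lower bound makes Y dominate half the squared distance to o, so Y satisfies a
  -- Gronwall inequality.
  set Y : ℕ → ℝ := fun n => dist o (x n) ^ 2 + τ₁ * (energy φ (x n) + A) with hY
  have hYd : ∀ n, dist o (x n) ^ 2 / 2 ≤ Y n := by
    intro n
    have h1 := mul_le_mul_of_nonneg_left (hlow _ (h.mem_dom hbot hx₀ n)) hτ₁.le
    have h2 : τ₁ * (dist o (x n) ^ 2 / (2 * τ₁)) = dist o (x n) ^ 2 / 2 := by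
      field_simp
    rw [mul_add, h2] at h1
    simp only [hY]
    linarith
  have hY0 : ∀ n, 0 ≤ Y n := fun n => le_trans (by positivity) (hYd n)
  have hstep : ∀ n, Y (n + 1) ≤ Y n + (4 / τ₁ * (P.t (n + 1) - P.t n)) * Y (n + 1) := by
    intro n
    have hp := P.step_pos n
    have e1 := h.sq_dist_succ_le hbot hx₀ n
    set τ := P.t (n + 1) - P.t n
    set v := dist (x n) (x (n + 1))
    set a := dist o (x n)
    set b := dist o (x (n + 1))
    have tri : b ≤ a + v := dist_triangle _ _ _
    have tri2 : a ≤ b + v := by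
      have := dist_triangle o (x (n + 1)) (x n)
      rwa [dist_comm (x (n + 1))] at this
    have hb0 : 0 ≤ b := dist_nonneg
    have ha0 : 0 ≤ a := dist_nonneg
    have hv0 : 0 ≤ v := dist_nonneg
    have e2 : b ^ 2 - a ^ 2 ≤ 2 * (v * b) := by
      rcases le_total a b with hab | hab
      · nlinarith [mul_le_mul (show b - a ≤ v by linarith) (show b + a ≤ 2 * b by linarith)
          (by positivity) hv0]
      · nlinarith [mul_nonneg hv0 hb0]
    -- The Young weight τ₁/(2τ) is chosen so that the energy drop absorbs the jump term; the rest is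
    -- of order τ b².
    have e3 : 2 * (v * b) ≤ τ₁ / (2 * τ) * v ^ 2 + 2 * τ / τ₁ * b ^ 2 := by
      have : 0 ≤ τ₁ / (2 * τ) * (v - 2 * τ / τ₁ * b) ^ 2 := by positivity
      have e : τ₁ / (2 * τ) * (v - 2 * τ / τ₁ * b) ^ 2 =
          τ₁ / (2 * τ) * v ^ 2 + 2 * τ / τ₁ * b ^ 2 - 2 * (v * b) := by
        field_simp
        ring
      linarith
    have e4 : τ₁ / (2 * τ) * v ^ 2 ≤ τ₁ * (energy φ (x n) - energy φ (x (n + 1))) := by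
      calc τ₁ / (2 * τ) * v ^ 2 ≤
            τ₁ / (2 * τ) * (2 * τ * (energy φ (x n) - energy φ (x (n + 1)))) :=
            mul_le_mul_of_nonneg_left e1 (by positivity)
        _ = _ := by field_simp
    have e5 : 2 * τ / τ₁ * b ^ 2 ≤ 4 / τ₁ * τ * Y (n + 1) := by
      have := mul_le_mul_of_nonneg_left (hYd (n + 1)) (show 0 ≤ 4 / τ₁ * τ by positivity)
      calc _ = 4 / τ₁ * τ * (dist o (x (n + 1)) ^ 2 / 2) := by ring
        _ ≤ _ := this
    have e6 : Y (n + 1) - Y n =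
        b ^ 2 - a ^ 2 - τ₁ * (energy φ (x n) - energy φ (x (n + 1))) := by
      simp only [hY, a, b]; ring
    linarith
  have hgr : ∀ n, Y n ≤ Real.exp (8 / τ₁ * P.t n) * Y 0 := by
    intro n
    induction n with
    | zero => simp [P.t_zero]
    | succ n ih =>
      have hp := P.step_pos n
      have hq : 4 / τ₁ * (P.t (n + 1) - P.t n) ≤ 1 / 2 := by
        have := mul_le_mul_of_nonneg_left (hP n).le (show 0 ≤ 4 / τ₁ by positivity)
        have e : 4 / τ₁ * (τ₁ / 8) = 1 / 2 := by field_simp; norm_num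
        linarith
      refine (le_exp_mul_of_le_add_mul (by positivity) hq (hY0 _) (hstep n)).trans ?_
      calc _ ≤ Real.exp (2 * (4 / τ₁ * (P.t (n + 1) - P.t n))) *
            (Real.exp (8 / τ₁ * P.t n) * Y 0) :=
            mul_le_mul_of_nonneg_left ih (Real.exp_pos _).le
        _ = _ := by rw [← mul_assoc, ← Real.exp_add]; congr 2; ring
  have hYn : Y n ≤ Real.exp (8 / τ₁ * T) * (R ^ 2 + τ₁ * (C + A)) := by
    refine (hgr n).trans (mul_le_mul ?_ ?_ (hY0 0) (Real.exp_pos _).le)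
    · exact Real.exp_le_exp.2 (mul_le_mul_of_nonneg_left hn (by positivity))
    · simp only [hY, h.1]
      have := pow_le_pow_left₀ dist_nonneg hR 2
      have := mul_le_mul_of_nonneg_left hC hτ₁.le
      linarith
  have h1 := hlow _ (h.mem_dom hbot hx₀ n)
  have h2 : dist o (x n) ^ 2 / (2 * τ₁) ≤
      Real.exp (8 / τ₁ * T) * (R ^ 2 + τ₁ * (C + A)) / τ₁ := by
    rw [← div_div]
    exact div_le_div_of_nonneg_right ((hYd n).trans hYn) hτ₁.le
  linarith

/-! ### Comparison of discrete solutions -/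

/-- The time intervals that end at the `i`-th node of `P` and at the `j`-th node of `Q` touch. -/
def Linked (P Q : TimePartition) (i j : ℕ) : Prop :=
  (∀ k, i = k + 1 → P.t k ≤ Q.t j) ∧ (∀ k, j = k + 1 → Q.t k ≤ P.t i)

lemma linked_index (P Q : TimePartition) (s : ℝ≥0) : Linked P Q (P.index s) (Q.index s) :=
  ⟨fun _ hk => (TimePartition.t_lt_of_index_eq_succ hk).le.trans (Q.le_t_index s),
    fun _ hk => (TimePartition.t_lt_of_index_eq_succ hk).le.trans (P.le_t_index s)⟩

lemma Linked.symm {i j : ℕ} (h : Linked P Q i j) : Linked Q P j i := ⟨h.2, h.1⟩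

lemma Linked.sub_le {i j : ℕ} (h : Linked P Q i j) {δ : ℝ} (hδ : 0 ≤ δ)
    (hP : ∀ k, P.t (k + 1) - P.t k ≤ δ) : P.t i - Q.t j ≤ δ := by
  rcases i with _ | k
  · rw [P.t_zero]; linarith [Q.t_nonneg j]
  · linarith [h.1 k rfl, hP k]

/-- One steps back in the partition whose previous node is the later one, or in the only one that
still has a previous node. This makes induction on i + j possible. -/
lemma Linked.pred {i j : ℕ} (h : Linked P Q i j) (hij : i + j ≠ 0) :
    (∃ k, i = k + 1 ∧ Linked P Q k j) ∨ (∃ k, j = k + 1 ∧ Linked P Q i k) := by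
  rcases i with _ | i <;> rcases j with _ | j
  · simp at hij
  · right
    refine ⟨j, rfl, fun _ hk => by omega, fun k hk => ?_⟩
    subst hk
    exact (Q.strictMono.monotone (Nat.le_succ k)).trans (h.2 (k + 1) rfl)
  · left
    refine ⟨i, rfl, fun k hk => ?_, fun _ hk => by omega⟩
    subst hk
    exact (P.strictMono.monotone (Nat.le_succ k)).trans (h.1 (k + 1) rfl)
  · rcases le_total (Q.t j) (P.t i) with hle | hle
    · left
      refine ⟨i, rfl, fun k hk => ?_, fun k hk => ?_⟩
      · subst hk
        exact (P.strictMono.monotone (Nat.le_succ k)).trans (h.1 (k + 1) rfl)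
      · obtain rfl : j = k := by omega
        exact hle
    · right
      refine ⟨j, rfl, fun k hk => ?_, fun k hk => ?_⟩
      · obtain rfl : i = k := by omega
        exact hle
      · subst hk
        exact (Q.strictMono.monotone (Nat.le_succ k)).trans (h.2 (k + 1) rfl)

/-- The quantity that is propagated along linked pairs of nodes. -/
def gap (φ : X → EReal) (P Q : TimePartition) (x y : ℕ → X) (c m : ℝ) (i j : ℕ) : ℝ :=
  dist (x i) (y j) ^ 2 + 2 * (P.t i - Q.t j) * (energy φ (x i) - energy φ (y j))
    + c * (energy φ (x i) + energy φ (y j) + 2 * m)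

lemma gap_symm (c m : ℝ) (i j : ℕ) : gap φ P Q x y c m i j = gap φ Q P y x c m j i := by
  simp only [gap, dist_comm (x i) (y j)]
  ring

/-- The product term may be negative, but linked nodes differ in time by at most δ, so the last term
with c ≥ 2δ compensates it. -/
lemma sq_dist_le_gap {i j : ℕ} {δ c m : ℝ} (hδ : |P.t i - Q.t j| ≤ δ) (hc : 2 * δ ≤ c)
    (hx : -m ≤ energy φ (x i)) (hy : -m ≤ energy φ (y j)) :
    dist (x i) (y j) ^ 2 ≤ gap φ P Q x y c m i j := by
  have h1 : |energy φ (x i) - energy φ (y j)| ≤ energy φ (x i) + energy φ (y j) + 2 * m := by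
    rw [abs_le]; constructor <;> linarith
  have hδ0 : 0 ≤ δ := (abs_nonneg _).trans hδ
  have h2 := mul_le_mul hδ h1 (abs_nonneg _) hδ0
  rw [← abs_mul] at h2
  have h3 := (abs_le.1 h2).1
  have h4 := mul_le_mul_of_nonneg_right hc
    (show 0 ≤ energy φ (x i) + energy φ (y j) + 2 * m by linarith)
  simp only [gap]
  linarith

/-- When i advances, the product term changes by 2τ(φ(xⁱ⁺¹) - φ(yʲ)), cancelling the energy term of
the variational inequality, plus an error of at most 2δ times the energy drop. The κ-term costs at
most 2κδ times that drop. The last term of `gap` decreases by (4 + 2κ)δ times the drop and pays for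
both. -/
lemma gap_succ_le (hbot : ∀ x, φ x ≠ ⊥) {l κ r : ℝ} (hl : 0 ≤ l) (hκ : 0 ≤ κ)
    (hevi : LocalEVI φ l κ r) (hx₀ : x₀ ∈ dom φ) (hy₀ : y₀ ∈ dom φ)
    (hx : IsDiscreteSolution φ P x₀ x) (hy : IsDiscreteSolution φ Q y₀ y) {δ m : ℝ} (hδ : 0 ≤ δ)
    (hlδ : l * δ ≤ 1 / 2) (hP : ∀ k, P.t (k + 1) - P.t k ≤ δ) (hQ : ∀ k, Q.t (k + 1) - Q.t k ≤ δ)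
    {i j : ℕ} (hl₁ : Linked P Q i j) (hl₂ : Linked P Q (i + 1) j)
    (hxm : -m ≤ energy φ (x (i + 1))) (hym : -m ≤ energy φ (y j))
    (hr₁ : dist (x i) (y j) < r / 2) (hr₂ : dist (x i) (x (i + 1)) < r / 2) :
    gap φ P Q x y ((4 + 2 * κ) * δ) m (i + 1) j ≤
      Real.exp (2 * (l * (P.t (i + 1) - P.t i))) * gap φ P Q x y ((4 + 2 * κ) * δ) m i j := by
  have hp := P.step_pos i
  have hrp : 0 ≤ dist (x i) (y j) := dist_nonneg
  have htri : dist (x (i + 1)) (y j) < r := by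
    have := dist_triangle (x (i + 1)) (x i) (y j)
    rw [dist_comm (x (i + 1)) (x i)] at this
    linarith
  have e1 := hevi _ hp (x i) (hx.mem_dom hbot hx₀ i) (x (i + 1)) (hx.2 i) (y j)
    (hy.mem_dom hbot hy₀ j) (by linarith) htri (by linarith)
  have e2 := hx.sq_dist_succ_le hbot hx₀ i
  have hd : 0 ≤ energy φ (x i) - energy φ (x (i + 1)) :=
    sub_nonneg.2 (hx.energy_antitone hbot hx₀ (Nat.le_succ i))
  have e3 : κ * dist (x i) (x (i + 1)) ^ 2 ≤
      2 * κ * δ * (energy φ (x i) - energy φ (x (i + 1))) := by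
    have h1 := mul_le_mul_of_nonneg_left e2 hκ
    have h2 := mul_le_mul_of_nonneg_right (hP i) (mul_nonneg hκ hd)
    nlinarith
  have e4 : Q.t j - P.t i ≤ δ := hl₁.symm.sub_le hδ hQ
  have e5 := mul_le_mul_of_nonneg_right e4 hd
  have e5' : 0 ≤ δ * (energy φ (x i) - energy φ (x (i + 1))) := mul_nonneg hδ hd
  have hgap : dist (x (i + 1)) (y j) ^ 2 ≤ gap φ P Q x y ((4 + 2 * κ) * δ) m (i + 1) j := by
    refine sq_dist_le_gap (δ := δ) (abs_le.2 ⟨?_, hl₂.sub_le hδ hP⟩) ?_ hxm hym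
    · linarith [hl₂.symm.sub_le hδ hQ]
    · nlinarith [mul_nonneg hκ hδ]
  have e6 := mul_le_mul_of_nonneg_left hgap (mul_nonneg hl hp.le)
  refine le_exp_mul_of_le_add_mul (mul_nonneg hl hp.le)
    ((mul_le_mul_of_nonneg_left (hP i) hl).trans hlδ) ((sq_nonneg _).trans hgap) ?_
  refine le_trans ?_ (add_le_add_right e6 _)
  simp only [gap]
  nlinarith

/-- Induction on i + j. The variational inequality is only local, so the bound at the previous pair
is also used to show that its points are within r/2; `hsmall` makes this self-consistent, and `hrδ`
keeps single jumps below r/2. -/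
lemma gap_le (hbot : ∀ x, φ x ≠ ⊥) {l κ r : ℝ} (hl : 0 ≤ l) (hκ : 0 ≤ κ) (hr : 0 < r)
    (hevi : LocalEVI φ l κ r) (hx₀ : x₀ ∈ dom φ) (hy₀ : y₀ ∈ dom φ)
    (hx : IsDiscreteSolution φ P x₀ x) (hy : IsDiscreteSolution φ Q y₀ y) {δ m T C : ℝ}
    (hδ : 0 ≤ δ) (hlδ : l * δ ≤ 1 / 2)
    (hP : ∀ k, P.t (k + 1) - P.t k ≤ δ) (hQ : ∀ k, Q.t (k + 1) - Q.t k ≤ δ)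
    (hxm : ∀ k, P.t k ≤ T → -m ≤ energy φ (x k)) (hym : ∀ k, Q.t k ≤ T → -m ≤ energy φ (y k))
    (hxC : energy φ x₀ ≤ C) (hyC : energy φ y₀ ≤ C) (hrδ : 2 * δ * (C + m) < (r / 2) ^ 2)
    (hsmall : Real.exp (2 * l * (2 * T)) * gap φ P Q x y ((4 + 2 * κ) * δ) m 0 0 < (r / 2) ^ 2)
    {i j : ℕ} (hij : Linked P Q i j) (hi : P.t i ≤ T) (hj : Q.t j ≤ T) :
    gap φ P Q x y ((4 + 2 * κ) * δ) m i j ≤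
      Real.exp (2 * l * (P.t i + Q.t j)) * gap φ P Q x y ((4 + 2 * κ) * δ) m 0 0 := by
  set c := (4 + 2 * κ) * δ with hc
  have h2c : 2 * δ ≤ c := by nlinarith [mul_nonneg hκ hδ]
  have hdg : ∀ i j, Linked P Q i j → P.t i ≤ T → Q.t j ≤ T →
      dist (x i) (y j) ^ 2 ≤ gap φ P Q x y c m i j := by
    intro i j hij hi hj
    refine sq_dist_le_gap (δ := δ) (abs_le.2 ⟨?_, hij.sub_le hδ hP⟩) h2c (hxm i hi) (hym j hj)
    linarith [hij.symm.sub_le hδ hQ]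
  have hT : 0 ≤ T := (P.t_nonneg i).trans hi
  have h00 : 0 ≤ gap φ P Q x y c m 0 0 :=
    (sq_nonneg _).trans (hdg 0 0 ⟨fun _ h => by omega, fun _ h => by omega⟩
      (P.t_zero.trans_le hT) (Q.t_zero.trans_le hT))
  have hclose : ∀ i j, Linked P Q i j → P.t i ≤ T → Q.t j ≤ T →
      gap φ P Q x y c m i j ≤ Real.exp (2 * l * (P.t i + Q.t j)) * gap φ P Q x y c m 0 0 →
      dist (x i) (y j) < r / 2 := by
    intro i j hij hi hj hg
    refine lt_of_pow_lt_pow_left₀ 2 (by positivity) (lt_of_le_of_lt ?_ hsmall)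
    refine (hdg i j hij hi hj).trans (hg.trans (mul_le_mul_of_nonneg_right ?_ h00))
    exact Real.exp_le_exp.2 (mul_le_mul_of_nonneg_left (by linarith) (by positivity))
  have hjump : ∀ {P' : TimePartition} {z₀ : X} {z : ℕ → X}, z₀ ∈ dom φ →
      IsDiscreteSolution φ P' z₀ z → (∀ k, P'.t (k + 1) - P'.t k ≤ δ) → energy φ z₀ ≤ C →
      ∀ k, -m ≤ energy φ (z (k + 1)) → dist (z k) (z (k + 1)) < r / 2 := by
    intro P' z₀ z hz₀ hz hP' hzC k hk
    refine lt_of_pow_lt_pow_left₀ 2 (by positivity) (lt_of_le_of_lt ?_ hrδ)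
    have h1 := hz.energy_antitone hbot hz₀ (Nat.zero_le k)
    have h2 := hz.energy_antitone hbot hz₀ (Nat.le_succ k)
    simp only [hz.1, Nat.succ_eq_add_one] at h1 h2
    refine (hz.sq_dist_succ_le hbot hz₀ k).trans (mul_le_mul ?_ ?_ ?_ (by positivity))
    · linarith [hP' k]
    · linarith
    · linarith
  induction hn : i + j generalizing i j with
  | zero =>
    obtain ⟨rfl, rfl⟩ : i = 0 ∧ j = 0 := by omega
    simp [P.t_zero, Q.t_zero]
  | succ n ih =>
    rcases hij.pred (by omega) with ⟨k, rfl, hk⟩ | ⟨k, rfl, hk⟩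
    · have hkT : P.t k ≤ T := (P.strictMono.monotone (Nat.le_succ k)).trans hi
      have ih' := ih hk hkT hj (by omega)
      refine (gap_succ_le hbot hl hκ hevi hx₀ hy₀ hx hy hδ hlδ hP hQ hk hij (hxm _ hi) (hym _ hj)
        (hclose _ _ hk hkT hj ih') (hjump hx₀ hx hP hxC k (hxm _ hi))).trans ?_
      refine (mul_le_mul_of_nonneg_left ih' (Real.exp_pos _).le).trans_eq ?_
      rw [← mul_assoc, ← Real.exp_add]
      congr 2
      ring
    · have hkT : Q.t k ≤ T := (Q.strictMono.monotone (Nat.le_succ k)).trans hj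
      have ih' := ih hk hi hkT (by omega)
      have hcl := hclose _ _ hk hi hkT ih'
      rw [dist_comm] at hcl
      have := gap_succ_le hbot hl hκ hevi hy₀ hx₀ hy hx hδ hlδ hQ hP hk.symm hij.symm (hym _ hj)
        (hxm _ hi) hcl (hjump hy₀ hy hQ hyC k (hym _ hj))
      simp only [gap_symm (P := Q) (Q := P) (x := y) (y := x)] at this
      refine this.trans ?_
      refine (mul_le_mul_of_nonneg_left ih' (Real.exp_pos _).le).trans_eq ?_
      rw [← mul_assoc, ← Real.exp_add]
      congr 2
      ring

end GradFlow

end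

noncomputable section

namespace GradFlow

variable {X : Type*} [MetricSpace X] {φ : X → EReal}

/-! ### Convergence of discrete solutions -/

/-- The properties of a functional from which the convergence of discrete solutions is derived. -/
structure IsEvolutive (φ : X → EReal) : Prop where
  ne_bot : ∀ x, φ x ≠ ⊥
  nonempty : (dom φ).Nonempty
  lsc : LowerSemicontinuous φ
  coercive : IsCoercive φ
  evi : ∃ l κ r : ℝ, 0 ≤ l ∧ 0 ≤ κ ∧ 0 < r ∧ LocalEVI φ l κ r

lemma IsEvolutive.of_cases [CompleteSpace X] (hbot : ∀ x, φ x ≠ ⊥) (hdom : (dom φ).Nonempty)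
    (hlsc : LowerSemicontinuous φ) {lam : ℝ} (h : CaseI φ lam ∨ CaseII φ lam) : IsEvolutive φ := by
  rcases h with ⟨hX, hφ, hd⟩ | h
  · refine ⟨hbot, hdom, hlsc, ?_, |lam|, 0, Real.pi / 2, abs_nonneg _, le_rfl,
      by linarith [Real.pi_pos], hX.localEVI hbot hφ⟩
    rcases hd with hd | hd
    · exact hX.isCoercive hbot hdom hlsc hφ hd
    · exact hd
  · exact ⟨hbot, hdom, hlsc, h.1, h.exists_localEVI hbot⟩

lemma IsCoercive.exists_discreteSolution (h : IsCoercive φ) :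
    ∃ τs : ℝ, 0 < τs ∧ ∀ P : TimePartition, (∀ k, P.t (k + 1) - P.t k < τs) → ∀ x₀ : X,
      ∃ x : ℕ → X, IsDiscreteSolution φ P x₀ x := by
  obtain ⟨τs, hτs, h⟩ := h
  refine ⟨τs, hτs, fun P hP x₀ => ?_⟩
  choose f hf using fun (k : ℕ) (z : X) => (h _ (P.step_pos k) (hP k) z).2
  exact ⟨fun n => Nat.rec x₀ (fun k z => f k z) n, rfl, fun k => hf k _⟩

/-- A quadratic lower bound of the energy. -/
lemma IsCoercive.exists_quadratic_bound (h : IsCoercive φ) (hbot : ∀ x, φ x ≠ ⊥)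
    (hdom : (dom φ).Nonempty) : ∃ (o : X) (A τ₁ : ℝ), 0 < τ₁ ∧
      ∀ z ∈ dom φ, -A ≤ energy φ z + dist o z ^ 2 / (2 * τ₁) := by
  obtain ⟨τs, hτs, h⟩ := h
  obtain ⟨o, ho⟩ := hdom
  obtain ⟨-, z₀, hz₀⟩ := h (τs / 2) (by positivity) (by linarith) o
  exact ⟨o, -(energy φ z₀ + dist o z₀ ^ 2 / (2 * (τs / 2))), τs / 2, by positivity, fun z hz => by
    rw [neg_neg]; exact energy_add_le_of_mem_resolventSet hbot ho hz₀ hz⟩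

lemma IsEvolutive.exists_energy_ge (h : IsEvolutive φ) (a : X) (C R T : ℝ) :
    ∃ m δ₀ : ℝ, 0 < δ₀ ∧ ∀ (P : TimePartition) (x₀ : X) (x : ℕ → X), x₀ ∈ dom φ →
      IsDiscreteSolution φ P x₀ x → (∀ k, P.t (k + 1) - P.t k < δ₀) → energy φ x₀ ≤ C →
      dist a x₀ ≤ R → ∀ n, P.t n ≤ T → -m ≤ energy φ (x n) := by
  obtain ⟨o, A, τ₁, hτ₁, hlow⟩ := h.coercive.exists_quadratic_bound h.ne_bot h.nonempty
  refine ⟨_, τ₁ / 8, by positivity, fun P x₀ x hx₀ hx hP hC hR n hn =>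
    hx.energy_ge h.ne_bot hx₀ hτ₁ hlow hP hC (R := dist o a + R) ?_ hn⟩
  exact (dist_triangle o a x₀).trans (by linarith)

/-- Stability of discrete solutions with respect to the starting point and the partition. -/
lemma IsEvolutive.exists_sq_dist_interp_le (h : IsEvolutive φ) (a : X) (C R : ℝ) (T : ℝ≥0) :
    ∃ M δ₀ : ℝ, 0 ≤ M ∧ 0 < δ₀ ∧ ∀ (P Q : TimePartition) (x₀ y₀ : X) (x y : ℕ → X) (δ : ℝ),
      x₀ ∈ dom φ → y₀ ∈ dom φ → IsDiscreteSolution φ P x₀ x → IsDiscreteSolution φ Q y₀ y →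
      δ ≤ δ₀ → (∀ k, P.t (k + 1) - P.t k < δ) → (∀ k, Q.t (k + 1) - Q.t k < δ) →
      energy φ x₀ ≤ C → energy φ y₀ ≤ C → dist a x₀ ≤ R → dist a y₀ ≤ R →
      dist x₀ y₀ ^ 2 ≤ δ₀ →
      ∀ s ≤ T, dist (interp P x s) (interp Q y s) ^ 2 ≤ M * (dist x₀ y₀ ^ 2 + δ) := by
  obtain ⟨l, κ, r, hl, hκ, hr, hevi⟩ := h.evi
  obtain ⟨m, δ₁, hδ₁, hm⟩ := h.exists_energy_ge a C R (T + 1)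
  set E := Real.exp (2 * l * (2 * ((T : ℝ) + 1))) with hE
  set S := |C + m| with hS
  have hS0 : 0 ≤ S := abs_nonneg _
  have hE0 : 0 < E := Real.exp_pos _
  set M := E * (1 + (4 + 2 * κ) * (2 * S)) with hM
  have hM0 : 0 ≤ M := by positivity
  set q := (r / 2) ^ 2 / (2 * (M + S + 1)) with hq
  have hq0 : 0 < q := by positivity
  have hqe : 2 * q * (M + S + 1) = (r / 2) ^ 2 := by rw [hq]; field_simp
  -- The bound 1 keeps the nodes used before T + 1, δ₁ gives the energy bound, 1/(2(l+1)) the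
  -- Gronwall step, and q keeps distances and jumps below r/2.
  refine ⟨M, min (min 1 δ₁) (min (1 / (2 * (l + 1))) q), hM0, by positivity, ?_⟩
  intro P Q x₀ y₀ x y δ hx₀ hy₀ hx hy hδ hP hQ hxC hyC hxR hyR hxy s hs
  have hδ0 : 0 < δ := (P.step_pos 0).trans (hP 0)
  have hδ1 : δ ≤ 1 := hδ.trans ((min_le_left _ _).trans (min_le_left _ _))
  have hδδ₁ : δ ≤ δ₁ := hδ.trans ((min_le_left _ _).trans (min_le_right _ _))
  have hδl : δ ≤ 1 / (2 * (l + 1)) := hδ.trans ((min_le_right _ _).trans (min_le_left _ _))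
  have hδq : δ ≤ q := hδ.trans ((min_le_right _ _).trans (min_le_right _ _))
  have hxyq : dist x₀ y₀ ^ 2 ≤ q := hxy.trans ((min_le_right _ _).trans (min_le_right _ _))
  have hxm := hm P x₀ x hx₀ hx (fun k => (hP k).trans_le hδδ₁) hxC hxR
  have hym := hm Q y₀ y hy₀ hy (fun k => (hQ k).trans_le hδδ₁) hyC hyR
  have hlδ : l * δ ≤ 1 / 2 := by
    rw [le_div_iff₀ (by positivity)] at hδl
    linarith
  have hCS : C + m ≤ S := le_abs_self _
  have hgap0 : E * gap φ P Q x y ((4 + 2 * κ) * δ) m 0 0 ≤ M * (dist x₀ y₀ ^ 2 + δ) := by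
    have h1 : gap φ P Q x y ((4 + 2 * κ) * δ) m 0 0 =
        dist x₀ y₀ ^ 2 + (4 + 2 * κ) * δ * (energy φ x₀ + energy φ y₀ + 2 * m) := by
      simp [gap, hx.1, hy.1, P.t_zero, Q.t_zero]
    have h2 : energy φ x₀ + energy φ y₀ + 2 * m ≤ 2 * S := by linarith
    have h3 := mul_le_mul_of_nonneg_left h2 (show 0 ≤ (4 + 2 * κ) * δ by positivity)
    have h4 : 0 ≤ (4 + 2 * κ) * (2 * S) * dist x₀ y₀ ^ 2 := by positivity
    rw [h1, hM, mul_assoc E]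
    refine mul_le_mul_of_nonneg_left ?_ hE0.le
    linarith
  have hMq : M * (dist x₀ y₀ ^ 2 + δ) < (r / 2) ^ 2 := by
    have := mul_le_mul_of_nonneg_left (show dist x₀ y₀ ^ 2 + δ ≤ 2 * q by linarith) hM0
    nlinarith [mul_nonneg hq0.le hS0]
  have hrδ : 2 * δ * (C + m) < (r / 2) ^ 2 := by
    have h1 := mul_le_mul_of_nonneg_left hCS hδ0.le
    have h2 := mul_le_mul_of_nonneg_right hδq hS0
    nlinarith [mul_nonneg hq0.le hM0]
  have hsT : (s : ℝ) ≤ T := NNReal.coe_le_coe.2 hs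
  have hiT : P.t (P.index s) ≤ T + 1 := by linarith [TimePartition.t_index_lt hδ0 hP s]
  have hjT : Q.t (Q.index s) ≤ T + 1 := by linarith [TimePartition.t_index_lt hδ0 hQ s]
  have hlink := linked_index P Q s
  have hPδ := fun k => (hP k).le
  have hQδ := fun k => (hQ k).le
  have key := gap_le h.ne_bot hl hκ hr hevi hx₀ hy₀ hx hy hδ0.le hlδ hPδ hQδ hxm hym hxC hyC hrδ
    (hgap0.trans_lt hMq) hlink hiT hjT
  have hg0 : dist (x (P.index s)) (y (Q.index s)) ^ 2 ≤
      gap φ P Q x y ((4 + 2 * κ) * δ) m (P.index s) (Q.index s) := by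
    refine sq_dist_le_gap (δ := δ) (abs_le.2 ⟨?_, hlink.sub_le hδ0.le hPδ⟩) ?_ (hxm _ hiT)
      (hym _ hjT)
    · linarith [hlink.symm.sub_le hδ0.le hQδ]
    · nlinarith [mul_nonneg hκ hδ0.le]
  have hg00 : 0 ≤ gap φ P Q x y ((4 + 2 * κ) * δ) m 0 0 :=
    nonneg_of_mul_nonneg_right ((sq_nonneg _).trans (hg0.trans key)) (Real.exp_pos _)
  calc dist (interp P x s) (interp Q y s) ^ 2
      ≤ gap φ P Q x y ((4 + 2 * κ) * δ) m (P.index s) (Q.index s) := hg0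
    _ ≤ _ := key
    _ ≤ E * gap φ P Q x y ((4 + 2 * κ) * δ) m 0 0 :=
        mul_le_mul_of_nonneg_right (Real.exp_le_exp.2 (mul_le_mul_of_nonneg_left
          (by linarith) (by positivity))) hg00
    _ ≤ _ := hgap0

/-! ### Equidistant reference partitions, existence and uniqueness of the limit curve -/

/-- The partition with equidistant nodes. -/
def uniformPartition (h : ℝ) (hh : 0 < h) : TimePartition where
  t k := k * h
  t_zero := by simp
  strictMono := fun a b hab => mul_lt_mul_of_pos_right (by exact_mod_cast hab) hh
  tendsto := tendsto_natCast_atTop_atTop.atTop_mul_const hh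

lemma uniformPartition_t (h : ℝ) (hh : 0 < h) (k : ℕ) : (uniformPartition h hh).t k = k * h := rfl

lemma uniformPartition_step (h : ℝ) (hh : 0 < h) (k : ℕ) :
    (uniformPartition h hh).t (k + 1) - (uniformPartition h hh).t k = h := by
  simp only [uniformPartition_t]; push_cast; ring

lemma mesh_uniformPartition (h : ℝ) (hh : 0 < h) :
    (uniformPartition h hh).mesh = ENNReal.ofReal h := by
  simp only [TimePartition.mesh, uniformPartition_step, iSup_const]

lemma index_uniformPartition_add {h : ℝ} (hh : 0 < h) (k : ℕ) {s : ℝ≥0} (hs : (s : ℝ) = k * h)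
    (t : ℝ≥0) : (uniformPartition h hh).index (s + t) = k + (uniformPartition h hh).index t := by
  set P := uniformPartition h hh
  apply le_antisymm
  · apply Nat.sInf_le
    have := P.le_t_index t
    simp only [mem_ofPred_eq, P, uniformPartition_t] at this ⊢
    push_cast
    linarith
  · have h1 := P.le_t_index (s + t)
    set n := P.index (s + t)
    simp only [P, uniformPartition_t, NNReal.coe_add, hs] at h1
    have hkn : k ≤ n := by
      have ht : (0 : ℝ) ≤ t := t.2
      have : (k : ℝ) * h ≤ n * h := by linarith
      exact_mod_cast le_of_mul_le_mul_right this hh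
    obtain ⟨j, hj⟩ := Nat.exists_eq_add_of_le hkn
    have : P.index t ≤ j := by
      apply Nat.sInf_le
      simp only [mem_ofPred_eq, P, uniformPartition_t]
      rw [hj] at h1
      push_cast at h1
      linarith
    omega

lemma interp_zero {Y : Type*} (P : TimePartition) (x : ℕ → Y) : interp P x 0 = x 0 :=
  congrArg x P.index_zero

lemma tendsto_mesh_uniformPartition {h : ℕ → ℝ} (hh : ∀ n, 0 < h n)
    (hlim : Tendsto h atTop (𝓝 0)) :
    Tendsto (fun n => (uniformPartition (h n) (hh n)).mesh) atTop (𝓝 0) := by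
  simp only [mesh_uniformPartition]
  simpa using ENNReal.tendsto_ofReal hlim

/-- Supplies actual discrete solutions with vanishing mesh; without them `IsLimitCurve` would hold
vacuously and could not determine the curve. -/
lemma IsEvolutive.exists_reference (h : IsEvolutive φ) (x₀ : X) :
    ∃ (s : ℕ → ℝ) (hs : ∀ n, 0 < s n) (x : ℕ → ℕ → X), Tendsto s atTop (𝓝 0) ∧
      ∀ n, IsDiscreteSolution φ (uniformPartition (s n) (hs n)) x₀ (x n) := by
  obtain ⟨τs, hτs, hex⟩ := h.coercive.exists_discreteSolution
  have hpos : ∀ n : ℕ, 0 < τs / 2 * (1 / ((n : ℝ) + 1)) := fun n => by positivity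
  have hsol : ∀ n : ℕ, ∃ x, IsDiscreteSolution φ
      (uniformPartition (τs / 2 * (1 / ((n : ℝ) + 1))) (hpos n)) x₀ x := by
    intro n
    refine hex _ (fun k => ?_) x₀
    rw [uniformPartition_step]
    have : 1 / ((n : ℝ) + 1) ≤ 1 := by
      rw [div_le_one (by positivity)]
      linarith [(Nat.cast_nonneg n : (0 : ℝ) ≤ n)]
    nlinarith
  choose x hx using hsol
  refine ⟨_, hpos, x, ?_, hx⟩
  simpa using (tendsto_one_div_add_atTop_nhds_zero_nat (𝕜 := ℝ)).const_mul (τs / 2)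

lemma IsEvolutive.limitCurve_unique (h : IsEvolutive φ) {x₀ : X} {ξ ζ : ℝ≥0 → X}
    (hξ : IsLimitCurve φ x₀ ξ) (hζ : IsLimitCurve φ x₀ ζ) : ξ = ζ := by
  obtain ⟨s, hs, x, hlim, hx⟩ := h.exists_reference x₀
  have hm := tendsto_mesh_uniformPartition hs hlim
  funext t
  exact tendsto_nhds_unique ((hξ.2 _ x hm hx t).tendsto_at (right_mem_Icc.2 (zero_le)))
    ((hζ.2 _ x hm hx t).tendsto_at (right_mem_Icc.2 (zero_le)))

lemma IsEvolutive.exists_dist_interp_lt (h : IsEvolutive φ) {x₀ : X} (hx₀ : x₀ ∈ dom φ) (T : ℝ≥0)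
    {ε : ℝ} (hε : 0 < ε) : ∃ δ : ℝ, 0 < δ ∧ ∀ (P Q : TimePartition) (x y : ℕ → X),
      IsDiscreteSolution φ P x₀ x → IsDiscreteSolution φ Q x₀ y →
      (∀ k, P.t (k + 1) - P.t k < δ) → (∀ k, Q.t (k + 1) - Q.t k < δ) →
      ∀ s ≤ T, dist (interp P x s) (interp Q y s) < ε := by
  obtain ⟨M, δ₀, hM, hδ₀, hle⟩ := h.exists_sq_dist_interp_le x₀ (energy φ x₀) 0 T
  refine ⟨min δ₀ (ε ^ 2 / (M + 1)), by positivity, fun P Q x y hx hy hP hQ s hs => ?_⟩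
  have h1 := hle P Q x₀ x₀ x y _ hx₀ hx₀ hx hy (min_le_left _ _) hP hQ le_rfl le_rfl
    (dist_self _).le (dist_self _).le (by simpa using hδ₀.le) s hs
  refine lt_of_pow_lt_pow_left₀ 2 hε.le (h1.trans_lt ?_)
  rw [dist_self, zero_pow two_ne_zero, zero_add]
  refine (mul_le_mul_of_nonneg_left (min_le_right _ _) hM).trans_lt ?_
  rw [mul_div_assoc', div_lt_iff₀ (by positivity)]
  nlinarith [pow_pos hε 2]

lemma IsEvolutive.exists_limitCurve [CompleteSpace X] (h : IsEvolutive φ) {x₀ : X}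
    (hx₀ : x₀ ∈ dom φ) : ∃ ξ : ℝ≥0 → X, IsLimitCurve φ x₀ ξ := by
  obtain ⟨s, hs, x, hlim, hx⟩ := h.exists_reference x₀
  have hstep : ∀ δ > 0, ∀ᶠ n in atTop, ∀ k, (uniformPartition (s n) (hs n)).t (k + 1)
      - (uniformPartition (s n) (hs n)).t k < δ := by
    intro δ hδ
    filter_upwards [hlim.eventually_lt_const hδ] with n hn k
    rwa [uniformPartition_step]
  have hcauchy : ∀ t : ℝ≥0,
      CauchySeq (fun n => interp (uniformPartition (s n) (hs n)) (x n) t) := by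
    intro t
    rw [Metric.cauchySeq_iff]
    intro ε hε
    obtain ⟨δ, hδ, hd⟩ := h.exists_dist_interp_lt hx₀ t hε
    obtain ⟨N, hN⟩ := eventually_atTop.1 (hstep δ hδ)
    exact ⟨N, fun m hm n hn => hd _ _ _ _ (hx m) (hx n) (hN m hm) (hN n hn) t le_rfl⟩
  choose ξ hξ using fun t => cauchySeq_tendsto_of_complete (hcauchy t)
  refine ⟨ξ, ?_, ?_⟩
  · refine tendsto_nhds_unique (hξ 0) ?_
    simp only [interp_zero, (hx _).1]
    exact tendsto_const_nhds
  · intro P y hP hy T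
    rw [Metric.tendstoUniformlyOn_iff]
    intro ε hε
    obtain ⟨δ, hδ, hd⟩ := h.exists_dist_interp_lt hx₀ T (half_pos hε)
    filter_upwards [hP.eventually_lt_const (ENNReal.ofReal_pos.2 hδ)] with i hi t ht
    refine lt_of_le_of_lt ?_ (half_lt_self hε)
    refine le_of_tendsto ((hξ t).dist tendsto_const_nhds) ?_
    filter_upwards [hstep δ hδ] with n hn
    exact (hd _ _ _ _ (hx n) (hy i) hn (TimePartition.step_lt_of_mesh_lt hi) t ht.2).le

/-! ### The semigroup -/

lemma IsLimitCurve.tendsto {x₀ : X} {ξ : ℝ≥0 → X} (hξ : IsLimitCurve φ x₀ ξ) {s : ℕ → ℝ}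
    (hs : ∀ n, 0 < s n) (hlim : Tendsto s atTop (𝓝 0)) {x : ℕ → ℕ → X}
    (hx : ∀ n, IsDiscreteSolution φ (uniformPartition (s n) (hs n)) x₀ (x n)) (t : ℝ≥0) :
    Tendsto (fun n => interp (uniformPartition (s n) (hs n)) (x n) t) atTop (𝓝 (ξ t)) :=
  (hξ.2 _ x (tendsto_mesh_uniformPartition hs hlim) hx t).tendsto_at (right_mem_Icc.2 (zero_le))

lemma IsEvolutive.limitCurve_mem_dom (h : IsEvolutive φ) {x₀ : X} (hx₀ : x₀ ∈ dom φ)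
    {ξ : ℝ≥0 → X} (hξ : IsLimitCurve φ x₀ ξ) (t : ℝ≥0) :
    ξ t ∈ dom φ ∧ energy φ (ξ t) ≤ energy φ x₀ := by
  obtain ⟨s, hs, x, hlim, hx⟩ := h.exists_reference x₀
  refine mem_dom_and_energy_le_of_tendsto h.ne_bot h.lsc (hξ.tendsto hs hlim hx t)
    (Eventually.of_forall fun n => ⟨(hx n).mem_dom h.ne_bot hx₀ _, ?_⟩)
  have := (hx n).energy_antitone h.ne_bot hx₀
    (Nat.zero_le ((uniformPartition (s n) (hs n)).index t))
  simp only [(hx n).1] at this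
  exact this

/-- The discrete 1/2-Hölder bound passes to the limit: nodes overshoot their times by less than 2 s
n, which tends to 0. -/
lemma IsEvolutive.exists_sq_dist_limitCurve_le (h : IsEvolutive φ) {x₀ : X} (hx₀ : x₀ ∈ dom φ)
    {ξ : ℝ≥0 → X} (hξ : IsLimitCurve φ x₀ ξ) (T : ℝ≥0) :
    ∃ B : ℝ, ∀ a b : ℝ≥0, a ≤ b → b ≤ T → dist (ξ a) (ξ b) ^ 2 ≤ B * dist a b := by
  obtain ⟨s, hs, x, hlim, hx⟩ := h.exists_reference x₀
  obtain ⟨m, δ₀, hδ₀, hm⟩ := h.exists_energy_ge x₀ (energy φ x₀) 0 (T + 1)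
  refine ⟨2 * (energy φ x₀ + m), fun a b hab hb => ?_⟩
  have habr : (a : ℝ) ≤ b := NNReal.coe_le_coe.2 hab
  have hbr : (b : ℝ) ≤ T := NNReal.coe_le_coe.2 hb
  have hdist : dist a b = b - a := by
    rw [NNReal.dist_eq, abs_sub_comm, abs_of_nonneg (sub_nonneg.2 habr)]
  have hB : Tendsto (fun n => 2 * (energy φ x₀ + m) * (dist a b + 2 * s n)) atTop
      (𝓝 (2 * (energy φ x₀ + m) * dist a b)) := by
    simpa using ((hlim.const_mul 2).const_add (dist a b)).const_mul (2 * (energy φ x₀ + m))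
  refine le_of_tendsto_of_tendsto
    (((hξ.tendsto hs hlim hx a).dist (hξ.tendsto hs hlim hx b)).pow 2) hB ?_
  filter_upwards [hlim.eventually_lt_const hδ₀,
    hlim.eventually_lt_const (show (0 : ℝ) < 1 / 2 by norm_num)] with n hn hn1
  set P := uniformPartition (s n) (hs n) with hP
  have hsn := hs n
  have hlt : ∀ c : ℝ≥0, P.t (P.index c) < c + 2 * s n :=
    TimePartition.t_index_lt (by linarith) (fun k => by rw [hP, uniformPartition_step]; linarith)
  have h1 := (hx n).sq_dist_le h.ne_bot hx₀ (P.index_mono hab)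
  have h2 := hm P x₀ (x n) hx₀ (hx n) (fun k => by rw [hP, uniformPartition_step]; exact hn) le_rfl
    (dist_self _).le (P.index b) (by linarith [hlt b])
  have h3 := (hx n).energy_antitone h.ne_bot hx₀ (Nat.zero_le (P.index a))
  have h4 := (hx n).energy_antitone h.ne_bot hx₀ (P.index_mono hab)
  have h5 := P.strictMono.monotone (P.index_mono hab)
  simp only [(hx n).1] at h3 h4
  calc dist (interp P (x n) a) (interp P (x n) b) ^ 2
      ≤ 2 * (P.t (P.index b) - P.t (P.index a)) *
        (energy φ (x n (P.index a)) - energy φ (x n (P.index b))) := h1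
    _ ≤ 2 * (dist a b + 2 * s n) * (energy φ x₀ + m) := by
        refine mul_le_mul ?_ (by linarith) (by linarith) (by positivity)
        linarith [hlt b, P.le_t_index a]
    _ = _ := by ring

lemma IsEvolutive.continuous_limitCurve (h : IsEvolutive φ) {x₀ : X} (hx₀ : x₀ ∈ dom φ)
    {ξ : ℝ≥0 → X} (hξ : IsLimitCurve φ x₀ ξ) : Continuous ξ := by
  rw [continuous_iff_continuousAt]
  intro t
  obtain ⟨B, hB⟩ := h.exists_sq_dist_limitCurve_le hx₀ hξ (t + 1)
  have hlim : Tendsto (fun s : ℝ≥0 => √(B * dist s t)) (𝓝 t) (𝓝 0) := by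
    have hc : Continuous (fun s : ℝ≥0 => √(B * dist s t)) := by fun_prop
    simpa using hc.tendsto t
  rw [ContinuousAt, tendsto_iff_dist_tendsto_zero]
  refine squeeze_zero' (Eventually.of_forall fun _ => dist_nonneg) ?_ hlim
  filter_upwards [eventually_lt_nhds (lt_add_of_pos_right t one_pos)] with s hs
  refine Real.le_sqrt_of_sq_le ?_
  rcases le_total s t with hst | hst
  · exact hB s t hst (le_add_of_nonneg_right zero_le_one)
  · rw [dist_comm (ξ s), dist_comm s]
    exact hB t s hst hs.le

lemma IsDiscreteSolution.shift {τ : ℝ} {hτ : 0 < τ} {x₀ : X} {x : ℕ → X}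
    (hx : IsDiscreteSolution φ (uniformPartition τ hτ) x₀ x) (k : ℕ) :
    IsDiscreteSolution φ (uniformPartition τ hτ) (x k) (fun j => x (k + j)) := by
  refine ⟨rfl, fun j => ?_⟩
  have := hx.2 (k + j)
  rwa [uniformPartition_step, ← uniformPartition_step τ hτ j] at this

/-- Take equidistant steps that divide s. The tail of the solution from x₀ after time s is again a
discrete solution, starting near ξ(s), and by stability it has the same limit as discrete solutions
from ξ(s). -/
lemma IsEvolutive.limitCurve_add (h : IsEvolutive φ) {x₀ : X} (hx₀ : x₀ ∈ dom φ)
    {ξ ζ : ℝ≥0 → X} (hξ : IsLimitCurve φ x₀ ξ) (s : ℝ≥0) (hζ : IsLimitCurve φ (ξ s) ζ) (t : ℝ≥0) :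
    ζ t = ξ (s + t) := by
  rcases eq_or_ne s 0 with rfl | hs0
  · rw [hξ.1] at hζ
    rw [h.limitCurve_unique hζ hξ, zero_add]
  have hs : (0 : ℝ) < s := NNReal.coe_pos.2 (pos_iff_ne_zero.2 hs0)
  obtain ⟨τs, hτs, hex⟩ := h.coercive.exists_discreteSolution
  obtain ⟨N, hN⟩ := exists_nat_gt ((s : ℝ) / τs)
  have hN0 : (0 : ℝ) < N := lt_trans (by positivity) hN
  -- The factor N > s/τs makes every step s / k n admissible for the existence of discrete
  -- solutions.
  set k : ℕ → ℕ := fun n => N * (n + 1)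
  have hk : ∀ n, (0 : ℝ) < k n := fun n => by simp only [k]; push_cast; positivity
  set τ : ℕ → ℝ := fun n => s / k n
  have hτ : ∀ n, 0 < τ n := fun n => div_pos hs (hk n)
  have hτlim : Tendsto τ atTop (𝓝 0) := by
    have := (tendsto_one_div_add_atTop_nhds_zero_nat (𝕜 := ℝ)).const_mul ((s : ℝ) / N)
    rw [mul_zero] at this
    refine this.congr fun n => ?_
    simp only [τ, k]
    push_cast
    field_simp
  have hτlt : ∀ n j, (uniformPartition (τ n) (hτ n)).t (j + 1)
      - (uniformPartition (τ n) (hτ n)).t j < τs := by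
    intro n j
    rw [uniformPartition_step]
    simp only [τ]
    rw [div_lt_iff₀ (hk n)]
    rw [div_lt_iff₀ hτs] at hN
    have : (N : ℝ) ≤ k n := by
      simp only [k]
      exact_mod_cast Nat.le_mul_of_pos_right N (Nat.succ_pos n)
    nlinarith
  choose x hx using fun n => hex _ (hτlt n) x₀
  choose y hy using fun n => hex _ (hτlt n) (ξ s)
  have hsk : ∀ n, (s : ℝ) = k n * τ n := fun n => by
    simp only [τ]; rw [mul_div_cancel₀ _ (hk n).ne']
  have hstart : Tendsto (fun n => x n (k n)) atTop (𝓝 (ξ s)) := by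
    refine (hξ.tendsto hτ hτlim hx s).congr fun n => ?_
    have := index_uniformPartition_add (hτ n) (k n) (hsk n) 0
    rw [add_zero, TimePartition.index_zero, add_zero] at this
    exact congrArg (x n) this
  have hxlim : Tendsto (fun n => interp (uniformPartition (τ n) (hτ n)) (fun j => x n (k n + j)) t)
      atTop (𝓝 (ξ (s + t))) := by
    refine (hξ.tendsto hτ hτlim hx (s + t)).congr fun n => ?_
    exact congrArg (x n) (index_uniformPartition_add (hτ n) (k n) (hsk n) t)
  have hylim := hζ.tendsto hτ hτlim hy t
  obtain ⟨hξd, hξe⟩ := h.limitCurve_mem_dom hx₀ hξ s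
  obtain ⟨M, δ₀, hM, hδ₀, hle⟩ := h.exists_sq_dist_interp_le (ξ s) (energy φ x₀) 1 t
  have hd0 : Tendsto (fun n => dist (x n (k n)) (ξ s) ^ 2) atTop (𝓝 0) := by
    simpa using (tendsto_iff_dist_tendsto_zero.1 hstart).pow 2
  have hMlim : Tendsto (fun n => M * (dist (x n (k n)) (ξ s) ^ 2 + 2 * τ n)) atTop (𝓝 0) := by
    simpa using (hd0.add (hτlim.const_mul 2)).const_mul M
  have hfin : dist (ξ (s + t)) (ζ t) ^ 2 ≤ 0 := by
    refine le_of_tendsto_of_tendsto ((hxlim.dist hylim).pow 2) hMlim ?_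
    filter_upwards [hd0.eventually_lt_const hδ₀, hτlim.eventually_lt_const (half_pos hδ₀),
      (tendsto_iff_dist_tendsto_zero.1 hstart).eventually_lt_const one_pos] with n h1 h2 h3
    -- The stability estimate needs steps strictly below δ, hence δ = 2 τ n.
    have hst : ∀ j, (uniformPartition (τ n) (hτ n)).t (j + 1)
        - (uniformPartition (τ n) (hτ n)).t j < 2 * τ n := fun j => by
      rw [uniformPartition_step]; linarith [hτ n]
    have hxe := (hx n).energy_antitone h.ne_bot hx₀ (Nat.zero_le (k n))
    simp only [(hx n).1] at hxe
    exact hle _ _ _ _ _ _ _ ((hx n).mem_dom h.ne_bot hx₀ _) hξd ((hx n).shift (k n)) (hy n)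
      (by linarith) hst hst hxe hξe (by rw [dist_comm]; exact h3.le) (by simp) h1.le t le_rfl
  have := pow_eq_zero_iff two_ne_zero |>.1 (le_antisymm hfin (sq_nonneg _))
  exact (dist_eq_zero.1 this).symm

end GradFlow

end

/-! ### The theorem on unique limits -/

theorem theorem4p2 {X : Type*} [MetricSpace X] [CompleteSpace X]
    (φ : X → EReal) (lam : ℝ)
    (hbot : ∀ x, φ x ≠ ⊥) (hdom : (GradFlow.dom φ).Nonempty)
    (hlsc : LowerSemicontinuous φ)
    (hcase : GradFlow.CaseI φ lam ∨ GradFlow.CaseII φ lam) :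
    -- discrete solutions exist for all sufficiently fine partitions
    (∃ δ : ℝ≥0∞, 0 < δ ∧ ∀ P : GradFlow.TimePartition, P.mesh < δ → ∀ x₀ ∈ GradFlow.dom φ,
      ∃ x : ℕ → X, GradFlow.IsDiscreteSolution φ P x₀ x) ∧
    -- they converge locally uniformly to one and the same curve
    (∀ x₀ ∈ GradFlow.dom φ, ∃! ξ : ℝ≥0 → X, GradFlow.IsLimitCurve φ x₀ ξ) ∧
    -- the limit curves are continuous, stay in the domain and form a semigroup
    (∃ G : ℝ≥0 → GradFlow.dom φ → GradFlow.dom φ,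
      (∀ x₀ : GradFlow.dom φ, GradFlow.IsLimitCurve φ (x₀ : X) (fun t => (G t x₀ : X))) ∧
      (∀ x₀ : GradFlow.dom φ, Continuous (fun t => G t x₀)) ∧
      (∀ x₀ : GradFlow.dom φ, G 0 x₀ = x₀) ∧
      (∀ (s t : ℝ≥0) (x₀ : GradFlow.dom φ), G t (G s x₀) = G (s + t) x₀)) := by
  have h := GradFlow.IsEvolutive.of_cases hbot hdom hlsc hcase
  refine ⟨?_, fun x₀ hx₀ => ?_, ?_⟩
  · obtain ⟨τs, hτs, hex⟩ := h.coercive.exists_discreteSolution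
    exact ⟨ENNReal.ofReal τs, ENNReal.ofReal_pos.2 hτs, fun P hP x₀ _ =>
      hex P (GradFlow.TimePartition.step_lt_of_mesh_lt hP) x₀⟩
  · obtain ⟨ξ, hξ⟩ := h.exists_limitCurve hx₀
    exact ⟨ξ, hξ, fun ζ hζ => h.limitCurve_unique hζ hξ⟩
  · choose ξ hξ using fun x₀ : GradFlow.dom φ => h.exists_limitCurve x₀.2
    refine ⟨fun t x₀ => ⟨ξ x₀ t, (h.limitCurve_mem_dom x₀.2 (hξ x₀) t).1⟩, hξ, fun x₀ => ?_,
      fun x₀ => Subtype.ext (hξ x₀).1, fun s t x₀ => Subtype.ext ?_⟩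
    · exact (h.continuous_limitCurve x₀.2 (hξ x₀)).subtype_mk _
    · exact h.limitCurve_add x₀.2 (hξ x₀) s (hξ _) t
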